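/- Let $\Bbbk$ be a field (of any characteristic). All operads are symmetric and $\Bbbk$-linear. An operad $\mathcal P$ is *unitary* if it comes with a basis element $1_0$ of the one-dimensional space $\mathcal P(0)=\Bbbk 1_0$; write $1=1_1\in\mathcal P(1)$ for the identity. It is *2-unitary* if moreover it comes with an element $1_2\in\mathcal P(2)$ such that $1_2\circ(1_0,1)=1=1_2\circ(1,1_0)$. Let $\mathrm{Com}$ be the operad of unital commutative algebras, $\mathrm{Com}(n)=\Bbbk$ for all $n\ge 0$. A *$\mathrm{Com}$-augmented operad* is a unitary operad $\mathcal P$ with a morphism of unitary operads $\mathrm{Com}\to\mathcal P$. For a unitary operad $\mathcal P$ and $I\subseteq\{1,\dots,n\}$ with characteristic function $\chi_I$, let $\pi^I:\mathcal P(n)\to\mathcal P(|I|)$, $\pi^I(\theta)=\theta\circ(1_{\chi_I(1)},\dots,1_{\chi_I(n)})$. For $k\ge 1$ let ${}^k\Upsilon(n)=\bigcap_{|I|=k-1}\ker\pi^I$ if $n\ge k$, and ${}^k\Upsilon(n)=0$ if $n<k$. The *signature* of $\mathcal P$ is the sequence $\mathcal S(\mathcal P)=(\dim_{\Bbbk}{}^k\Upsilon(k))_{k\ge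 1}$. The operad $\mathcal P$ is *locally finite* if $\dim_\Bbbk\mathcal P(n)<\infty$ for all $n$; its *exponent* is then $\exp(\mathcal P)=\limsup_{n\to\infty}(\dim_\Bbbk\mathcal P(n))^{1/n}\in[0,\infty]$. **Theorem 0.8.** 1. For every sequence $\mathbf d=(d_1,d_2,\dots)$ of non-negative integers there is a $\mathrm{Com}$-augmented operad $\mathcal P$ with $\mathcal S(\mathcal P)=\mathbf d$. 2. The exponent maps the class of locally finite $\mathrm{Com}$-augmented operads onto $\{1\}\cup[2,\infty]$, and it maps the class of locally finite 2-unitary operads onto $\{1\}\cup[2,\infty]$. That is, in both cases the set of all values of $\exp$ is exactly $\{1\}\cup[2,\infty]$. -/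

import Mathlib

open scoped ENNReal

universe u v w

namespace KOperad

/-- Transport of an operation along an equality of arities. -/
def arityCast {P : ℕ → Type v} {m n : ℕ} (h : m = n) (θ : P m) : P n := h ▸ θ

/-- The total number of inputs of `θ ∘ (θ₁ ∘ (θ₁₁, …), …, θₙ ∘ (θₙ₁, …))`, computed in
the two possible ways. The inputs of `θ ∘ (θ₁, …, θₙ)` are numbered in lexicographic order by
`finSigmaFinEquiv : (Σ i, Fin (k i)) ≃ Fin (∑ i, k i)`. -/
theorem sum_sum_arity {n : ℕ} {k : Fin n → ℕ} (l : (i : Fin n) → Fin (k i) → ℕ) :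
    ∑ p : Fin (∑ i, k i), l (finSigmaFinEquiv.symm p).1 (finSigmaFinEquiv.symm p).2 =
      ∑ i, ∑ j, l i j := by
  rw [Equiv.sum_comp finSigmaFinEquiv.symm (fun q : (i : Fin n) × Fin (k i) => l q.1 q.2),
    Fintype.sum_sigma]

theorem sum_perm_arity {n : ℕ} (k : Fin n → ℕ) (σ : Equiv.Perm (Fin n)) :
    ∑ i, k (σ.symm i) = ∑ i, k i :=
  Equiv.sum_comp σ.symm k

theorem sum_one_arity (n : ℕ) : ∑ _i : Fin n, 1 = n := by simp

theorem sum_fin_one_arity (n : ℕ) : ∑ _i : Fin 1, n = n := by simp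

/-- The block permutation `ϑ(σ; τ₁, …, τₙ)` of `k₁ + ⋯ + kₙ` letters. Its inverse sends the `j`-th
element of the `i`-th block, for the subdivision into blocks of sizes
`k_{σ⁻¹(1)}, …, k_{σ⁻¹(n)}`, to the element number `τ_{σ⁻¹(i)}⁻¹(j)` of the block number
`σ⁻¹(i)`, for the subdivision into blocks of sizes `k₁, …, kₙ`. -/
def blockPerm {n : ℕ} (k : Fin n → ℕ) (σ : Equiv.Perm (Fin n))
    (τ : (i : Fin n) → Equiv.Perm (Fin (k i))) : Equiv.Perm (Fin (∑ i, k i)) :=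
  Equiv.symm <|
    (finCongr (sum_perm_arity k σ).symm).trans <|
      finSigmaFinEquiv.symm.trans <|
        (Equiv.sigmaCongr (β₁ := fun i => Fin (k (σ.symm i))) (β₂ := fun a => Fin (k a)) σ.symm
          (fun i => (τ (σ.symm i)).symm)).trans finSigmaFinEquiv

end KOperad

open KOperad

/-- A symmetric `k`-linear operad (classical definition): a right `k[S_n]`-module `P(n)` for each
`n ≥ 0`, an identity in `P(1)`, and multilinear compositions
`P(n) × P(k₁) × ⋯ × P(kₙ) → P(k₁ + ⋯ + kₙ)` that are unital, associative and equivariant. -/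
structure SymmOperad (k : Type u) [Field k] where
  /-- The space `P(n)` of `n`-ary operations. -/
  carrier : ℕ → Type v
  [instAddCommGroup : ∀ n, AddCommGroup (carrier n)]
  [instModule : ∀ n, Module k (carrier n)]
  /-- The right action `θ * σ` of the symmetric group. -/
  act : {n : ℕ} → Equiv.Perm (Fin n) → carrier n →ₗ[k] carrier n
  act_one : ∀ {n : ℕ} (θ : carrier n), act 1 θ = θ
  act_mul : ∀ {n : ℕ} (σ τ : Equiv.Perm (Fin n)) (θ : carrier n),
    act (σ * τ) θ = act τ (act σ θ)
  /-- The identity operation. -/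
  one : carrier 1
  /-- The composition `θ ∘ (θ₁, …, θₙ)`. -/
  comp : {n : ℕ} → (k' : Fin n → ℕ) → carrier n →ₗ[k]
    MultilinearMap k (fun i : Fin n => carrier (k' i)) (carrier (∑ i, k' i))
  comp_one : ∀ {n : ℕ} (θ : carrier n),
    arityCast (sum_one_arity n) (comp (fun _ : Fin n => 1) θ (fun _ => one)) = θ
  one_comp : ∀ {n : ℕ} (θ : carrier n),
    arityCast (sum_fin_one_arity n) (comp (fun _ : Fin 1 => n) one (fun _ => θ)) = θ
  comp_assoc : ∀ {n : ℕ} (k' : Fin n → ℕ) (l : (i : Fin n) → Fin (k' i) → ℕ)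
    (θ : carrier n) (θ' : (i : Fin n) → carrier (k' i))
    (θ'' : (i : Fin n) → (j : Fin (k' i)) → carrier (l i j)),
    comp (fun i => ∑ j, l i j) θ (fun i => comp (l i) (θ' i) (θ'' i)) =
      arityCast (sum_sum_arity l)
        (comp (fun p => l (finSigmaFinEquiv.symm p).1 (finSigmaFinEquiv.symm p).2)
          (comp k' θ θ')
          (fun p => θ'' (finSigmaFinEquiv.symm p).1 (finSigmaFinEquiv.symm p).2))
  comp_equivariant : ∀ {n : ℕ} (k' : Fin n → ℕ) (σ : Equiv.Perm (Fin n))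
    (τ : (i : Fin n) → Equiv.Perm (Fin (k' i))) (θ : carrier n)
    (θ' : (i : Fin n) → carrier (k' i)),
    comp k' (act σ θ) (fun i => act (τ i) (θ' i)) =
      act (blockPerm k' σ τ)
        (arityCast (sum_perm_arity k' σ)
          (comp (fun i => k' (σ.symm i)) θ (fun i => θ' (σ.symm i))))

attribute [instance] SymmOperad.instAddCommGroup SymmOperad.instModule

namespace SymmOperad

variable {k : Type u} [Field k]

/-- A morphism of operads: linear maps `P(n) → Q(n)` compatible with the symmetric group actions,
the identities and the compositions. -/
structure Hom (P : SymmOperad.{u, v} k) (Q : SymmOperad.{u, w} k) where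
  map : {n : ℕ} → P.carrier n →ₗ[k] Q.carrier n
  map_act : ∀ {n : ℕ} (σ : Equiv.Perm (Fin n)) (θ : P.carrier n),
    map (P.act σ θ) = Q.act σ (map θ)
  map_one : map P.one = Q.one
  map_comp : ∀ {n : ℕ} (k' : Fin n → ℕ) (θ : P.carrier n) (θ' : (i : Fin n) → P.carrier (k' i)),
    map (P.comp k' θ θ') = Q.comp k' (map θ) (fun i => map (θ' i))

/-- The two-element tuple `(θ₁, θ₂)`. -/
def pair (P : SymmOperad.{u, v} k) {m n : ℕ} (θ₁ : P.carrier m) (θ₂ : P.carrier n) :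
    (i : Fin 2) → P.carrier (![m, n] i)
  | 0 => θ₁
  | 1 => θ₂

/-- The composition `θ ∘ (θ₁, θ₂)` for a binary operation `θ`. -/
def comp₂ (P : SymmOperad.{u, v} k) {m n : ℕ} (θ : P.carrier 2)
    (θ₁ : P.carrier m) (θ₂ : P.carrier n) : P.carrier (m + n) :=
  arityCast (Fin.sum_univ_two ![m, n]) (P.comp ![m, n] θ (P.pair θ₁ θ₂))

/-- `P` is locally finite if every `P(n)` is finite dimensional. -/
def LocallyFinite (P : SymmOperad.{u, v} k) : Prop :=
  ∀ n, Module.Finite k (P.carrier n)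

/-- The exponent `limsup (dim P(n))^(1/n)` (meant for locally finite operads). -/
noncomputable def exponent (P : SymmOperad.{u, v} k) : ℝ≥0∞ :=
  Filter.limsup
    (fun n : ℕ => ((Module.finrank k (P.carrier n) : ℕ) : ℝ≥0∞) ^ (1 / (n : ℝ))) Filter.atTop

/-- The operad `Com` of unital commutative algebras: `Com(n) = k` with basis element `1` for all
`n ≥ 0`, the symmetric groups act trivially, and `1 ∘ (1, …, 1) = 1`. -/
def com (k : Type u) [Field k] : SymmOperad.{u, u} k where
  carrier _ := k
  act _ := LinearMap.id
  act_one _ := rfl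
  act_mul _ _ _ := rfl
  one := 1
  comp {n} _ := LinearMap.toSpanSingleton k (MultilinearMap k (fun _ : Fin n => k) k)
    (MultilinearMap.mkPiAlgebra k (Fin n) k)
  comp_one := by
    intro n θ
    have h : ∀ {a b : ℕ} (e : a = b) (x : k), arityCast (P := fun _ => k) e x = x := by
      intro a b e x; subst e; rfl
    rw [h]; simp
  one_comp := by
    intro n θ
    have h : ∀ {a b : ℕ} (e : a = b) (x : k), arityCast (P := fun _ => k) e x = x := by
      intro a b e x; subst e; rfl
    rw [h]; simp
  comp_assoc := by
    intro n k' l θ θ' θ''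
    have h : ∀ {a b : ℕ} (e : a = b) (x : k), arityCast (P := fun _ => k) e x = x := by
      intro a b e x; subst e; rfl
    rw [h]
    simp only [LinearMap.toSpanSingleton_apply, smul_eq_mul, _root_.smul_apply,
      MultilinearMap.mkPiAlgebra_apply]
    rw [Equiv.prod_comp finSigmaFinEquiv.symm
      (fun q : (i : Fin n) × Fin (k' i) => θ'' q.1 q.2), Fintype.prod_sigma,
      Finset.prod_mul_distrib, mul_assoc]
  comp_equivariant := by
    intro n k' σ τ θ θ'
    have h : ∀ {a b : ℕ} (e : a = b) (x : k), arityCast (P := fun _ => k) e x = x := by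
      intro a b e x; subst e; rfl
    rw [h]
    simp only [LinearMap.id_apply, LinearMap.toSpanSingleton_apply, smul_eq_mul,
      _root_.smul_apply, MultilinearMap.mkPiAlgebra_apply]
    rw [Equiv.prod_comp σ.symm θ']

end SymmOperad

/-- A unitary operad: an operad `P` with a chosen basis element `1₀` of `P(0)`. -/
structure UnitaryOperad (k : Type u) [Field k] extends SymmOperad.{u, v} k where
  /-- The `0`-unit `1₀`. -/
  zeroUnit : carrier 0
  zeroUnit_ne_zero : zeroUnit ≠ 0
  span_zeroUnit : Submodule.span k {zeroUnit} = ⊤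

namespace UnitaryOperad

variable {k : Type u} [Field k] (P : UnitaryOperad.{u, v} k)

/-- The operation `1_{χ_I(i)}`, that is, the identity if `i ∈ I` and `1₀` if `i ∉ I`. -/
def unitAt {n : ℕ} (I : Finset (Fin n)) (i : Fin n) : P.carrier (if i ∈ I then 1 else 0) :=
  if h : i ∈ I then arityCast (if_pos h).symm P.one else arityCast (if_neg h).symm P.zeroUnit

/-- The restriction operator `π^I(θ) = θ ∘ (1_{χ_I(1)}, …, 1_{χ_I(n)})`. Its values have arity
`∑ i, χ_I(i)`, which is the cardinality of `I`. -/
def restrict {n : ℕ} (I : Finset (Fin n)) :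
    P.carrier n →ₗ[k] P.carrier (∑ i : Fin n, if i ∈ I then 1 else 0) where
  toFun θ := P.comp (fun i => if i ∈ I then 1 else 0) θ (P.unitAt I)
  map_add' θ₁ θ₂ := by simp
  map_smul' c θ := by simp

/-- The component of arity `n` of the `m`-th truncation of `P`: everything if `m = 0`; if `m ≥ 1`,
the intersection of the kernels of the `π^I` with `|I| = m - 1` for `n ≥ m`, and `0` for
`n < m`. -/
def truncation : ℕ → (n : ℕ) → Submodule k (P.carrier n)
  | 0, _ => ⊤
  | m + 1, n =>
    if m + 1 ≤ n then ⨅ (I : Finset (Fin n)) (_ : I.card = m), LinearMap.ker (P.restrict I)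
    else ⊥

/-- The signature `(d₁, d₂, …)` of `P`, where `dₙ` is the dimension of the component of arity `n`
of the `n`-th truncation. -/
noncomputable def signature : ℕ+ → Cardinal.{v} :=
  fun n => Module.rank k (P.truncation n n)

end UnitaryOperad

/-- A 2-unitary operad: a unitary operad with a chosen 2-unit `1₂` in `P(2)`, that is,
`1₂ ∘ (1₀, 1) = 1 = 1₂ ∘ (1, 1₀)`. -/
structure TwoUnitaryOperad (k : Type u) [Field k] extends UnitaryOperad.{u, v} k where
  /-- The 2-unit `1₂`. -/
  twoUnit : carrier 2
  left_unit : toSymmOperad.comp₂ twoUnit zeroUnit one = one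
  right_unit : toSymmOperad.comp₂ twoUnit one zeroUnit = one

/-- An object of the category of `Com`-augmented operads: a unitary operad `P` with a morphism of
unitary operads `Com → P`. -/
structure ComAugmentedOperad (k : Type u) [Field k] extends UnitaryOperad.{u, v} k where
  /-- The morphism `Com → P`. -/
  fromCom : (SymmOperad.com k).Hom toSymmOperad
  fromCom_zeroUnit : fromCom.map (n := 0) (1 : k) = zeroUnit

/-! Realisation: extend `Com` by an ideal of square zero. In arity n take k plus the functions
sending each nonempty set J of inputs to a vector in k^{d_|J|}. The coefficient of a composite at J
comes from the outer operation when J meets every block at most once, and from an inner one when J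
lies in its block. Both cases are one product of dual numbers (`SquareZeroOperad.ev_comp`), so the
axioms reduce to the combinatorics of blocks. Restriction to I keeps the labels J ⊆ I, so the n-th
truncation in arity n consists of the functions supported on the full set and has dimension d_n.
With the convention d_0 = 1, dim P(n) = ∑ C(n,m) d_m. Taking d_m = ⌊(r-1)^m⌋ gives exponent r for r
≥ 2; d_m = m^m gives ∞, and d = 0 in positive degrees gives 1.

Gap: let P be 2-unitary and locally finite. If the top truncations vanish from K on, an operation is
determined by its restrictions to fewer than K inputs
(`UnitaryOperad.eq_zero_of_forall_res_eq_zero`), so dim P(n) grows polynomially and the exponent is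
1. Otherwise nonzero θ in the top truncation exist in arbitrarily large arities a. The permuted
copies of 1₂ ∘ (θ, w) give C(a+b, a) independent operations (`TwoUnitaryOperad.choose_le_finrank`),
and b = a forces exponent at least 2. Since `Com`-augmented operads are 2-unitary, this settles both
classes. -/

namespace KOperad

/-! ### Combinatorics of blocks of inputs -/

/-- The block containing a position of a concatenation of blocks. -/
def blockOf {n : ℕ} {k' : Fin n → ℕ} (p : Fin (∑ i, k' i)) : Fin n :=
  (finSigmaFinEquiv.symm p).1

/-- The part of a set of positions that lies in the `i`-th block. -/
def blockPart {n : ℕ} {k' : Fin n → ℕ} (J : Finset (Fin (∑ i, k' i))) (i : Fin n) :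
    Finset (Fin (k' i)) :=
  Finset.univ.filter fun j => finSigmaFinEquiv ⟨i, j⟩ ∈ J

@[simp]
theorem mem_blockPart {n : ℕ} {k' : Fin n → ℕ} {J : Finset (Fin (∑ i, k' i))} {i : Fin n}
    {j : Fin (k' i)} : j ∈ blockPart J i ↔ finSigmaFinEquiv ⟨i, j⟩ ∈ J := by
  simp [blockPart]

@[simp]
theorem blockOf_finSigmaFinEquiv {n : ℕ} {k' : Fin n → ℕ} (i : Fin n) (j : Fin (k' i)) :
    blockOf (finSigmaFinEquiv ⟨i, j⟩) = i := by
  simp [blockOf]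

theorem mem_image_blockOf {n : ℕ} {k' : Fin n → ℕ} {J : Finset (Fin (∑ i, k' i))} {i : Fin n} :
    i ∈ J.image blockOf ↔ ∃ j : Fin (k' i), finSigmaFinEquiv ⟨i, j⟩ ∈ J := by
  simp only [Finset.mem_image]
  constructor
  · rintro ⟨p, hp, rfl⟩
    exact ⟨(finSigmaFinEquiv.symm p).2, by simpa [blockOf] using hp⟩
  · rintro ⟨j, hj⟩
    exact ⟨_, hj, by simp⟩

theorem card_blockPart_le {n : ℕ} {k' : Fin n → ℕ} (J : Finset (Fin (∑ i, k' i))) (i : Fin n) :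
    (blockPart J i).card ≤ J.card := by
  refine Finset.card_le_card_of_injOn (fun j => finSigmaFinEquiv ⟨i, j⟩)
    (fun j hj => by simpa using hj) ?_
  intro a _ b _ h
  simpa using h

theorem finSigmaFinEquiv_lt_iff {n : ℕ} {k' : Fin n → ℕ} (i i' : Fin n) (j : Fin (k' i))
    (j' : Fin (k' i')) :
    finSigmaFinEquiv (⟨i, j⟩ : (i : Fin n) × Fin (k' i)) < finSigmaFinEquiv ⟨i', j'⟩ ↔
      i < i' ∨ ∃ h : i = i', h ▸ j < j' := by
  have key : ∀ (i i' : Fin n) (j : Fin (k' i)) (j' : Fin (k' i')), i < i' →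
      finSigmaFinEquiv (⟨i, j⟩ : (i : Fin n) × Fin (k' i)) < finSigmaFinEquiv ⟨i', j'⟩ := by
    intro i i' j j' h
    rw [Fin.lt_def, finSigmaFinEquiv_apply, finSigmaFinEquiv_apply]
    have h1 : ∀ i : Fin n, ∑ a : Fin (i : ℕ), k' (Fin.castLE i.2.le a) =
        ∑ a ∈ Finset.range i, if h : a < n then k' ⟨a, h⟩ else 0 := by
      intro i
      rw [Finset.sum_range]
      refine Finset.sum_congr rfl fun a _ => ?_
      rw [dif_pos (a.2.trans i.2)]; rfl
    simp only
    rw [h1 i, h1 i']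
    have h2 : ∑ a ∈ Finset.range (i + 1), (if h : a < n then k' ⟨a, h⟩ else 0) ≤
        ∑ a ∈ Finset.range i', if h : a < n then k' ⟨a, h⟩ else 0 :=
      Finset.sum_le_sum_of_subset (Finset.range_subset_range.2 h)
    rw [Finset.sum_range_succ, dif_pos i.2] at h2
    have := j.2
    simp only [Fin.eta] at h2
    omega
  rcases lt_trichotomy i i' with h | rfl | h
  · simp [h, key i i' j j' h]
  · rw [Fin.lt_def, finSigmaFinEquiv_apply, finSigmaFinEquiv_apply]
    simp
  · have h3 := key i' i j' j h
    constructor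
    · intro h'; exact absurd h3 (not_lt.2 h'.le)
    · rintro (h' | ⟨rfl, -⟩)
      · exact absurd h (not_lt.2 h'.le)
      · exact absurd h (lt_irrefl _)

theorem finSigmaFinEquiv_val_eq_sum_ite {n : ℕ} {k' : Fin n → ℕ} (i : Fin n) (j : Fin (k' i)) :
    (finSigmaFinEquiv (⟨i, j⟩ : (i : Fin n) × Fin (k' i)) : ℕ) =
      (∑ a, if a < i then k' a else 0) + j := by
  rw [finSigmaFinEquiv_apply]
  congr 1
  rw [← Finset.sum_filter]
  refine Finset.sum_bij (fun a _ => Fin.castLE i.2.le a) ?_ ?_ ?_ ?_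
  · intro a _; exact Finset.mem_filter.2 ⟨Finset.mem_univ _, a.2⟩
  · intro a _ b _ h; simpa [Fin.ext_iff] using h
  · intro b hb; exact ⟨⟨b, by simpa using hb⟩, by simp, by simp⟩
  · intro a _; rfl

/-- The lexicographic numberings of iterated blocks are compatible. -/
theorem finSigmaFinEquiv_assoc {n : ℕ} {k' : Fin n → ℕ} (l : (i : Fin n) → Fin (k' i) → ℕ)
    (p : Fin (∑ i, k' i)) (x : Fin (l (finSigmaFinEquiv.symm p).1 (finSigmaFinEquiv.symm p).2)) :
    finSigmaFinEquiv (⟨(finSigmaFinEquiv.symm p).1,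
        finSigmaFinEquiv ⟨(finSigmaFinEquiv.symm p).2, x⟩⟩ :
        (i : Fin n) × Fin (∑ j, l i j)) =
      Fin.cast (sum_sum_arity l) (finSigmaFinEquiv (⟨p, x⟩ : (p : Fin (∑ i, k' i)) ×
        Fin (l (finSigmaFinEquiv.symm p).1 (finSigmaFinEquiv.symm p).2))) := by
  have hp : p = finSigmaFinEquiv (⟨(finSigmaFinEquiv.symm p).1, (finSigmaFinEquiv.symm p).2⟩ :
      (i : Fin n) × Fin (k' i)) := (Equiv.apply_symm_apply _ _).symm
  -- A position is the total size of the preceding blocks plus an offset. It remains to see that the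
  -- fine blocks before `p` are those in earlier coarse blocks together with the earlier ones in the
  -- same coarse block.
  rw [Fin.ext_iff, Fin.val_cast, finSigmaFinEquiv_val_eq_sum_ite, finSigmaFinEquiv_val_eq_sum_ite,
    finSigmaFinEquiv_val_eq_sum_ite, ← add_assoc]
  congr 1
  have h := Equiv.sum_comp (finSigmaFinEquiv (n := k')).symm
    (fun q => if finSigmaFinEquiv q < p then l q.1 q.2 else 0)
  simp only [Equiv.apply_symm_apply] at h
  rw [h, Fintype.sum_sigma]
  clear h x
  generalize finSigmaFinEquiv.symm p = q at hp ⊢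
  obtain ⟨i, j⟩ := q
  subst hp
  simp only [finSigmaFinEquiv_lt_iff]
  rw [← Finset.sum_erase_add _ _ (Finset.mem_univ i),
    ← Finset.sum_erase_add (s := Finset.univ)
      (f := fun a => ∑ b, if a < i ∨ ∃ h : a = i, h ▸ b < j then l a b else 0)
      (h := Finset.mem_univ i)]
  simp only [lt_irrefl, if_false, add_zero, false_or, exists_const]
  congr 1
  · refine Finset.sum_congr rfl fun a ha => ?_
    have ha' : a ≠ i := Finset.ne_of_mem_erase ha
    by_cases h : a < i
    · simp [h]
    · simp [h, ha']

theorem exists_finSigmaFinEquiv {n : ℕ} {k' : Fin n → ℕ} (p : Fin (∑ i, k' i)) :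
    ∃ i j, finSigmaFinEquiv ⟨i, j⟩ = p :=
  ⟨_, _, (Equiv.apply_symm_apply finSigmaFinEquiv p)⟩

theorem blockPerm_finSigmaFinEquiv {n : ℕ} (k' : Fin n → ℕ) (σ : Equiv.Perm (Fin n))
    (τ : (i : Fin n) → Equiv.Perm (Fin (k' i))) (i : Fin n) (j : Fin (k' (σ.symm i))) :
    blockPerm k' σ τ (finSigmaFinEquiv ⟨σ.symm i, (τ (σ.symm i)).symm j⟩) =
      Fin.cast (sum_perm_arity k' σ)
        (finSigmaFinEquiv (⟨i, j⟩ : (i : Fin n) × Fin (k' (σ.symm i)))) := by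
  rw [blockPerm, Equiv.symm_apply_eq]
  simp [finCongr, Equiv.sigmaCongr]

end KOperad

/-! ### Operations of the square-zero extension -/

namespace SquareZeroOperad
variable (k : Type u) [Field k] (d : ℕ → ℕ)

/-- Labels of the basis of the augmentation ideal in arity `n`: nonempty sets of inputs together
with one of `d |J|` colours. -/
abbrev Idx (n : ℕ) : Type :=
  {p : Finset (Fin n) × ℕ // p.1.Nonempty ∧ p.2 < d p.1.card}

/-- Operations of arity `n`: a multiple of the generator of `Com(n)` plus an element of the
augmentation ideal. -/
abbrev Carrier (n : ℕ) : Type u := k × (Idx d n → k)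

variable {k d}

/-- The coefficient at `(J, a)`, taken to be zero unless `|J| = m`. -/
def coeff {n : ℕ} (m a : ℕ) (J : Finset (Fin n)) : Carrier k d n →ₗ[k] k :=
  if h : J.card = m ∧ J.Nonempty ∧ a < d J.card then
    (LinearMap.proj (⟨(J, a), h.2⟩ : Idx d n)) ∘ₗ LinearMap.snd k k (Idx d n → k)
  else 0

/-- The scalar part plus `ε` times the coefficient at `(J, a)`. -/
def ev {n : ℕ} (m a : ℕ) (J : Finset (Fin n)) : Carrier k d n →ₗ[k] DualNumber k :=
  (TrivSqZeroExt.inlAlgHom k k k).toLinearMap ∘ₗ LinearMap.fst k k (Idx d n → k) +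
    TrivSqZeroExt.inrHom k k ∘ₗ coeff m a J

theorem fst_ev {n : ℕ} (m a : ℕ) (J : Finset (Fin n)) (F : Carrier k d n) :
    (ev m a J F).fst = F.1 := by simp [ev]

theorem snd_ev {n : ℕ} (m a : ℕ) (J : Finset (Fin n)) (F : Carrier k d n) :
    (ev m a J F).snd = coeff m a J F := by simp [ev]

theorem ev_eq_inl {n : ℕ} {m a : ℕ} {J : Finset (Fin n)} {F : Carrier k d n}
    (h : coeff m a J F = 0) : ev m a J F = TrivSqZeroExt.inl F.1 := by
  ext
  · simp [fst_ev]
  · simp [snd_ev, h]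

theorem coeff_of_card_ne {n : ℕ} {m a : ℕ} {J : Finset (Fin n)} (h : J.card ≠ m)
    (F : Carrier k d n) : coeff m a J F = 0 := by
  rw [coeff, dif_neg (fun h' => h h'.1)]; rfl

theorem coeff_of_le {n : ℕ} {m a : ℕ} {J : Finset (Fin n)} (h : d m ≤ a)
    (F : Carrier k d n) : coeff m a J F = 0 := by
  rw [coeff, dif_neg]; · rfl
  rintro ⟨rfl, -, h'⟩; omega

theorem coeff_idx {n : ℕ} (x : Idx d n) (F : Carrier k d n) :
    coeff x.1.1.card x.1.2 x.1.1 F = F.2 x := by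
  rw [coeff, dif_pos ⟨rfl, x.2⟩]; rfl

/-- Reduces each operad axiom to identities between dual numbers, one size `m` and colour `a` at a
time. -/
theorem carrier_ext {n : ℕ} {F G : Carrier k d n} (h₁ : F.1 = G.1)
    (h : ∀ (m a : ℕ) (J : Finset (Fin n)), 0 < m → J.card = m → ev m a J F = ev m a J G) :
    F = G := by
  refine Prod.ext h₁ (funext fun x => ?_)
  have := congrArg TrivSqZeroExt.snd (h x.1.1.card x.1.2 x.1.1 (Finset.card_pos.2 x.2.1) rfl)
  rwa [snd_ev, snd_ev, coeff_idx, coeff_idx] at this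

/-- The action `(F * σ)(J) = F(σ J)` of the symmetric group. -/
def act {n : ℕ} (σ : Equiv.Perm (Fin n)) : Carrier k d n →ₗ[k] Carrier k d n :=
  (LinearMap.fst k k _).prod
    (LinearMap.pi fun x => coeff x.1.1.card x.1.2 (x.1.1.map σ.toEmbedding))

theorem act_fst {n : ℕ} (σ : Equiv.Perm (Fin n)) (F : Carrier k d n) : (act σ F).1 = F.1 := rfl

theorem ev_act {n : ℕ} (m a : ℕ) (J : Finset (Fin n)) (σ : Equiv.Perm (Fin n))
    (F : Carrier k d n) (hm : 0 < m) :
    ev m a J (act σ F) = ev m a (J.map σ.toEmbedding) F := by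
  by_cases h : J.card = m ∧ a < d m
  · obtain ⟨rfl, h⟩ := h
    ext
    · simp [fst_ev, act_fst]
    · rw [snd_ev, snd_ev]
      exact coeff_idx (⟨(J, a), Finset.card_pos.1 hm, h⟩ : Idx d n) (act σ F)
  · rw [ev_eq_inl, ev_eq_inl, act_fst]
    all_goals
      by_cases h1 : J.card = m
      · exact coeff_of_le (by tauto |> not_lt.1) _
      · exact coeff_of_card_ne (by simpa using h1) _

/-- Composition, as a multilinear map in the inner operations. -/
def compAux {n : ℕ} (k' : Fin n → ℕ) (F : Carrier k d n) :
    MultilinearMap k (fun i : Fin n => Carrier k d (k' i)) (Carrier k d (∑ i, k' i)) :=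
  MultilinearMap.prod
    ((LinearMap.mulLeft k F.1).compMultilinearMap
      ((MultilinearMap.mkPiAlgebra k (Fin n) k).compLinearMap fun _ => LinearMap.fst k k _))
    (MultilinearMap.pi fun x =>
      (TrivSqZeroExt.sndHom k k ∘ₗ
        LinearMap.mulLeft k (ev x.1.1.card x.1.2 (x.1.1.image blockOf) F)).compMultilinearMap
      ((MultilinearMap.mkPiAlgebra k (Fin n) (DualNumber k)).compLinearMap
        fun i => ev x.1.1.card x.1.2 (blockPart x.1.1 i)))

/-- Composition. -/
def comp {n : ℕ} (k' : Fin n → ℕ) : Carrier k d n →ₗ[k]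
    MultilinearMap k (fun i : Fin n => Carrier k d (k' i)) (Carrier k d (∑ i, k' i)) where
  toFun := compAux k'
  map_add' F G := by
    ext x
    · simp [compAux, add_mul]
    · simp [compAux, add_mul]
  map_smul' c F := by
    ext x
    · simp [compAux]
    · simp [compAux]

theorem comp_fst {n : ℕ} (k' : Fin n → ℕ) (F : Carrier k d n) (G : ∀ i, Carrier k d (k' i)) :
    (comp k' F G).1 = F.1 * ∏ i, (G i).1 := rfl

theorem prod_inl {ι : Type*} (s : Finset ι) (c : ι → k) :
    ∏ i ∈ s, (TrivSqZeroExt.inl (c i) : DualNumber k) = TrivSqZeroExt.inl (∏ i ∈ s, c i) :=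
  (map_prod (TrivSqZeroExt.inlHom k k) c s).symm

/-- For `J` of size `m`, the ε-part receives a term from `F` only if `J` meets `m` different blocks,
and one from `G i` only if `J` lies in block `i`. Fixing `m` while `J` may be smaller makes the rule
stable under images and block parts, as associativity needs. Larger `J` must be excluded, since
their image could have exactly `m` elements. -/
theorem ev_comp {n : ℕ} (k' : Fin n → ℕ) (F : Carrier k d n) (G : ∀ i, Carrier k d (k' i))
    (m a : ℕ) (J : Finset (Fin (∑ i, k' i))) (hm : 0 < m) (hJ : J.card ≤ m) :
    ev m a J (comp k' F G) = ev m a (J.image blockOf) F * ∏ i, ev m a (blockPart J i) (G i) := by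
  by_cases h : J.card = m ∧ a < d m
  · obtain ⟨rfl, h⟩ := h
    ext
    · rw [fst_ev, TrivSqZeroExt.fst_mul, fst_ev, comp_fst]
      congr 1
      rw [← TrivSqZeroExt.fstHom_apply (S := k), map_prod]
      simp [fst_ev]
    · rw [snd_ev]
      exact coeff_idx (⟨(J, a), Finset.card_pos.1 hm, h⟩ : Idx d _) (comp k' F G)
  -- Here no colour `a` exists or `J` is too small; images and parts of `J` are no larger, so only
  -- scalars survive on both sides.
  · have key : ∀ {r : ℕ} (K : Finset (Fin r)) (H : Carrier k d r), K.card ≤ J.card →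
        coeff m a K H = 0 := by
      intro r K H hK
      by_cases h1 : J.card = m
      · exact coeff_of_le (by tauto |> not_lt.1) _
      · exact coeff_of_card_ne (by omega) _
    rw [ev_eq_inl (key _ _ le_rfl), ev_eq_inl (key _ _ Finset.card_image_le), comp_fst,
      TrivSqZeroExt.inl_mul, ← prod_inl]
    congr 1
    exact Finset.prod_congr rfl fun i _ => (ev_eq_inl (key _ _ (card_blockPart_le J i))).symm

omit [Field k] in
theorem arityCast_fst {m n : ℕ} (h : m = n) (F : Carrier k d m) :
    (arityCast (P := Carrier k d) h F).1 = F.1 := by subst h; rfl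

theorem ev_arityCast {m n : ℕ} (h : m = n) (F : Carrier k d m) (r a : ℕ) (J : Finset (Fin n)) :
    ev r a J (arityCast (P := Carrier k d) h F) = ev r a (J.image (Fin.cast h.symm)) F := by
  subst h
  congr 1
  simp

theorem ev_scalar {n : ℕ} (m a : ℕ) (J : Finset (Fin n)) (c : k) :
    ev m a J ((c, 0) : Carrier k d n) = TrivSqZeroExt.inl c := by
  refine ev_eq_inl ?_
  rw [coeff]
  split <;> rfl

end SquareZeroOperad

/-! ### Block identities behind the operad axioms -/

namespace KOperad

theorem mem_image_cast {m n : ℕ} (h : n = m) (J : Finset (Fin n)) (p : Fin m) :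
    p ∈ J.image (Fin.cast h) ↔ Fin.cast h.symm p ∈ J := by
  subst h; simp

theorem image_blockOf_one {n : ℕ} (J : Finset (Fin n)) :
    (J.image (Fin.cast (sum_one_arity n).symm)).image blockOf = J := by
  have h : ∀ i : Fin n, Fin.cast (sum_one_arity n)
      (finSigmaFinEquiv (⟨i, 0⟩ : (_ : Fin n) × Fin 1)) = i := by
    intro i
    rw [Fin.ext_iff, Fin.val_cast, finSigmaFinEquiv_apply]
    simp
  ext i
  rw [mem_image_blockOf]
  simp only [mem_image_cast]
  constructor
  · rintro ⟨j, hj⟩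
    rwa [Subsingleton.elim j 0, h] at hj
  · intro hi
    exact ⟨0, by rwa [h]⟩

theorem blockPart_one {n : ℕ} (J : Finset (Fin n)) :
    blockPart (k' := fun _ : Fin 1 => n) (J.image (Fin.cast (sum_fin_one_arity n).symm)) 0 = J := by
  ext j
  rw [mem_blockPart, mem_image_cast]
  congr! 1
  rw [Fin.ext_iff, Fin.val_cast, finSigmaFinEquiv_one]

section assoc

variable {n : ℕ} {k' : Fin n → ℕ} (l : (i : Fin n) → Fin (k' i) → ℕ)
  (J : Finset (Fin (∑ i, ∑ j, l i j)))

theorem blockPart_assoc (p : Fin (∑ i, k' i)) :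
    blockPart (k' := fun p => l (finSigmaFinEquiv.symm p).1 (finSigmaFinEquiv.symm p).2)
        (J.image (Fin.cast (sum_sum_arity l).symm)) p =
      blockPart (blockPart J (finSigmaFinEquiv.symm p).1) (finSigmaFinEquiv.symm p).2 := by
  ext x
  rw [mem_blockPart, mem_blockPart, mem_blockPart, mem_image_cast, finSigmaFinEquiv_assoc]

theorem mem_image_blockOf_cast (p : Fin (∑ i, k' i)) :
    p ∈ (J.image (Fin.cast (sum_sum_arity l).symm)).image
      (blockOf (k' := fun p => l (finSigmaFinEquiv.symm p).1 (finSigmaFinEquiv.symm p).2)) ↔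
    (finSigmaFinEquiv.symm p).2 ∈ (blockPart J (finSigmaFinEquiv.symm p).1).image blockOf := by
  rw [mem_image_blockOf, mem_image_blockOf]
  simp only [mem_image_cast, mem_blockPart, ← finSigmaFinEquiv_assoc]

theorem blockPart_image_blockOf (i : Fin n) :
    blockPart ((J.image (Fin.cast (sum_sum_arity l).symm)).image
      (blockOf (k' := fun p => l (finSigmaFinEquiv.symm p).1 (finSigmaFinEquiv.symm p).2))) i =
    (blockPart J i).image blockOf := by
  ext j
  rw [mem_blockPart, mem_image_blockOf_cast]
  generalize hq : finSigmaFinEquiv.symm (finSigmaFinEquiv ⟨i, j⟩) = q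
  rw [Equiv.symm_apply_apply] at hq
  subst hq
  rfl

theorem image_blockOf_assoc :
    J.image blockOf = ((J.image (Fin.cast (sum_sum_arity l).symm)).image
      (blockOf (k' := fun p => l (finSigmaFinEquiv.symm p).1
        (finSigmaFinEquiv.symm p).2))).image blockOf := by
  ext i
  rw [mem_image_blockOf, mem_image_blockOf]
  have h : ∀ j, finSigmaFinEquiv ⟨i, j⟩ ∈ _ ↔ _ := fun j =>
    mem_blockPart.symm.trans (Finset.ext_iff.1 (blockPart_image_blockOf l J i) j)
  simp only [h]
  constructor
  · rintro ⟨j, hj⟩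
    obtain ⟨a, b, rfl⟩ := exists_finSigmaFinEquiv j
    exact ⟨a, mem_image_blockOf.2 ⟨b, mem_blockPart.2 hj⟩⟩
  · rintro ⟨a, h⟩
    obtain ⟨b, hb⟩ := mem_image_blockOf.1 h
    exact ⟨_, mem_blockPart.1 hb⟩

end assoc

section equivariant

variable {n : ℕ} (k' : Fin n → ℕ) (σ : Equiv.Perm (Fin n))
    (τ : (i : Fin n) → Equiv.Perm (Fin (k' i))) (J : Finset (Fin (∑ i, k' i)))

theorem mem_map_blockPerm (i : Fin n) (j : Fin (k' (σ.symm i))) :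
    finSigmaFinEquiv (⟨i, j⟩ : (i : Fin n) × Fin (k' (σ.symm i))) ∈
      (J.map (blockPerm k' σ τ).toEmbedding).image (Fin.cast (sum_perm_arity k' σ).symm) ↔
    finSigmaFinEquiv ⟨σ.symm i, (τ (σ.symm i)).symm j⟩ ∈ J := by
  rw [mem_image_cast, ← blockPerm_finSigmaFinEquiv k' σ τ]
  simp [-Equiv.coe_toEmbedding]

theorem blockPart_map_blockPerm (i : Fin n) :
    blockPart (k' := fun i => k' (σ.symm i)) ((J.map (blockPerm k' σ τ).toEmbedding).image
      (Fin.cast (sum_perm_arity k' σ).symm)) i =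
    (blockPart J (σ.symm i)).map (τ (σ.symm i)).toEmbedding := by
  ext j
  rw [mem_blockPart, mem_map_blockPerm, Finset.mem_map_equiv, mem_blockPart]

theorem image_blockOf_map_blockPerm :
    ((J.map (blockPerm k' σ τ).toEmbedding).image
      (Fin.cast (sum_perm_arity k' σ).symm)).image (blockOf (k' := fun i => k' (σ.symm i))) =
    (J.image blockOf).map σ.toEmbedding := by
  ext i
  rw [mem_image_blockOf, Finset.mem_map_equiv, mem_image_blockOf]
  simp only [mem_map_blockPerm]
  exact (τ (σ.symm i)).symm.exists_congr_left.trans (by simp)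

end equivariant

end KOperad

/-! ### The square-zero extension as a `Com`-augmented operad -/

/-- The extension of `Com` by an ideal of square zero with the signature `d`. Its augmentation
ideal consists in arity `n` of the functions on the nonempty subsets `J` of the inputs with values
in `k ^ d |J|`. -/
def squareZeroOperad (k : Type u) [Field k] (d : ℕ → ℕ) : SymmOperad.{u, u} k where
  carrier := SquareZeroOperad.Carrier k d
  act := SquareZeroOperad.act
  act_one θ := by
    refine SquareZeroOperad.carrier_ext rfl fun m a J hm _ => ?_
    rw [SquareZeroOperad.ev_act _ _ _ _ _ hm]
    congr 2
    exact Finset.map_refl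
  act_mul σ τ θ := by
    refine SquareZeroOperad.carrier_ext rfl fun m a J hm _ => ?_
    rw [SquareZeroOperad.ev_act _ _ _ _ _ hm, SquareZeroOperad.ev_act _ _ _ _ _ hm,
      SquareZeroOperad.ev_act _ _ _ _ _ hm, Finset.map_map]
    congr 1
  one := (1, 0)
  comp := SquareZeroOperad.comp
  comp_one {n} θ := by
    refine SquareZeroOperad.carrier_ext ?_ fun m a J hm hJ => ?_
    · rw [SquareZeroOperad.arityCast_fst, SquareZeroOperad.comp_fst]; simp
    · rw [SquareZeroOperad.ev_arityCast, SquareZeroOperad.ev_comp _ _ _ _ _ _ hm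
        (Finset.card_image_le.trans hJ.le), image_blockOf_one]
      simp [SquareZeroOperad.ev_scalar]
  one_comp {n} θ := by
    refine SquareZeroOperad.carrier_ext ?_ fun m a J hm hJ => ?_
    · rw [SquareZeroOperad.arityCast_fst, SquareZeroOperad.comp_fst]; simp
    · rw [SquareZeroOperad.ev_arityCast, SquareZeroOperad.ev_comp _ _ _ _ _ _ hm
        (Finset.card_image_le.trans hJ.le), Fin.prod_univ_one, blockPart_one]
      simp [SquareZeroOperad.ev_scalar]
  comp_assoc {n} k' l θ θ' θ'' := by
    refine SquareZeroOperad.carrier_ext ?_ fun m a J hm hJ => ?_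
    · rw [SquareZeroOperad.arityCast_fst]
      simp only [SquareZeroOperad.comp_fst]
      rw [Equiv.prod_comp finSigmaFinEquiv.symm
        (fun q : (i : Fin n) × Fin (k' i) => (θ'' q.1 q.2).1), Fintype.prod_sigma,
        Finset.prod_mul_distrib, mul_assoc]
    · have hJ' : (J.image (Fin.cast (sum_sum_arity l).symm)).card ≤ m :=
        Finset.card_image_le.trans hJ.le
      rw [SquareZeroOperad.ev_arityCast, SquareZeroOperad.ev_comp _ _ _ _ _ _ hm hJ.le,
        SquareZeroOperad.ev_comp _ _ _ _ _ _ hm hJ', SquareZeroOperad.ev_comp _ _ _ _ _ _ hm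
          (Finset.card_image_le.trans hJ'), ← image_blockOf_assoc, mul_assoc]
      congr 1
      simp only [blockPart_assoc, blockPart_image_blockOf]
      rw [Equiv.prod_comp finSigmaFinEquiv.symm (fun q : (i : Fin n) × Fin (k' i) =>
        SquareZeroOperad.ev m a (blockPart (blockPart J q.1) q.2) (θ'' q.1 q.2)),
        Fintype.prod_sigma, ← Finset.prod_mul_distrib]
      exact Finset.prod_congr rfl fun i _ =>
        SquareZeroOperad.ev_comp _ _ _ _ _ _ hm ((card_blockPart_le J i).trans hJ.le)
  comp_equivariant {n} k' σ τ θ θ' := by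
    refine SquareZeroOperad.carrier_ext ?_ fun m a J hm hJ => ?_
    · rw [SquareZeroOperad.act_fst, SquareZeroOperad.arityCast_fst]
      simp only [SquareZeroOperad.comp_fst, SquareZeroOperad.act_fst]
      rw [Equiv.prod_comp σ.symm (fun i => (θ' i).1)]
    · rw [SquareZeroOperad.ev_comp _ _ _ _ _ _ hm hJ.le, SquareZeroOperad.ev_act _ _ _ _ _ hm,
        SquareZeroOperad.ev_act _ _ _ _ _ hm, SquareZeroOperad.ev_arityCast,
        SquareZeroOperad.ev_comp _ _ _ _ _ _ hm
          (Finset.card_image_le.trans (by rw [Finset.card_map, hJ])),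
        image_blockOf_map_blockPerm]
      congr 1
      simp only [blockPart_map_blockPerm, SquareZeroOperad.ev_act _ _ _ _ _ hm]
      rw [Equiv.prod_comp σ.symm (fun i =>
        SquareZeroOperad.ev m a ((blockPart J i).map (τ i).toEmbedding) (θ' i))]

theorem UnitaryOperad.mem_truncation_succ_iff {k : Type u} [Field k]
    (P : UnitaryOperad.{u, v} k) {m n : ℕ} (h : m + 1 ≤ n) (θ : P.carrier n) :
    θ ∈ P.truncation (m + 1) n ↔ ∀ I : Finset (Fin n), I.card = m → P.restrict I θ = 0 := by
  rw [UnitaryOperad.truncation, if_pos h]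
  simp only [Submodule.mem_iInf, LinearMap.mem_ker]

/-- The square-zero extension of `Com`, as a `Com`-augmented operad. -/
def squareZeroComAugmented (k : Type u) [Field k] (d : ℕ → ℕ) : ComAugmentedOperad.{u, u} k where
  toSymmOperad := squareZeroOperad k d
  zeroUnit := ((1, 0) : SquareZeroOperad.Carrier k d 0)
  zeroUnit_ne_zero h := one_ne_zero (congrArg Prod.fst h)
  span_zeroUnit := by
    refine Submodule.eq_top_iff'.2 fun F => Submodule.mem_span_singleton.2 ⟨Prod.fst F, ?_⟩
    refine Prod.ext (mul_one _) (funext fun x => ?_)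
    exact absurd x.2.1 (by simp [Finset.eq_empty_of_isEmpty])
  fromCom :=
    { map := LinearMap.inl k k _
      map_act := fun σ (c : k) => by
        refine SquareZeroOperad.carrier_ext rfl fun m a J hm _ => ?_
        exact (SquareZeroOperad.ev_scalar m a J c).trans
          ((SquareZeroOperad.ev_act m a J σ _ hm).trans
            (SquareZeroOperad.ev_scalar m a _ c)).symm
      map_one := rfl
      map_comp := fun {n} k' (c : k) (c' : Fin n → k) => by
        refine SquareZeroOperad.carrier_ext rfl fun m a J hm hJ => ?_
        refine (SquareZeroOperad.ev_scalar m a J (c * ∏ i, c' i)).trans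
          ((SquareZeroOperad.ev_comp k' _ _ m a J hm hJ.le).trans ?_).symm
        rw [TrivSqZeroExt.inl_mul, ← SquareZeroOperad.prod_inl]
        exact congrArg₂ (· * ·) (SquareZeroOperad.ev_scalar _ _ _ _)
          (Finset.prod_congr rfl fun _ _ => SquareZeroOperad.ev_scalar _ _ _ _) }
  fromCom_zeroUnit := rfl

/-! ### Signature and dimensions of the square-zero extension -/

namespace SquareZeroOperad
variable {k : Type u} [Field k] {d : ℕ → ℕ}

theorem unitAt_eq {n : ℕ} (I : Finset (Fin n)) (i : Fin n) :
    (squareZeroComAugmented k d).unitAt I i = ((1, 0) : Carrier k d _) := by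
  have h : ∀ {a b : ℕ} (e : a = b),
      arityCast (P := Carrier k d) e ((1, 0) : Carrier k d a) = (1, 0) := by
    intro a b e; subst e; rfl
  rw [UnitaryOperad.unitAt]
  split
  · exact h _
  · exact h _

theorem blockOf_injective {n : ℕ} (I : Finset (Fin n)) :
    Function.Injective (blockOf (k' := fun i => if i ∈ I then 1 else 0)) := by
  intro p q h
  obtain ⟨i, j, rfl⟩ := exists_finSigmaFinEquiv p
  obtain ⟨i', j', rfl⟩ := exists_finSigmaFinEquiv q
  rw [blockOf_finSigmaFinEquiv, blockOf_finSigmaFinEquiv] at h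
  subst h
  have : Subsingleton (Fin (if i ∈ I then 1 else 0)) := by
    split <;> infer_instance
  rw [Subsingleton.elim j j']

theorem range_blockOf {n : ℕ} (I : Finset (Fin n)) :
    Set.range (blockOf (k' := fun i => if i ∈ I then 1 else 0)) = I := by
  ext i
  constructor
  · rintro ⟨p, rfl⟩
    obtain ⟨i, j, rfl⟩ := exists_finSigmaFinEquiv p
    rw [blockOf_finSigmaFinEquiv]
    by_contra h
    rw [Finset.mem_coe] at h
    exact (Fin.cast (if_neg h) j).elim0
  · intro hi
    exact ⟨finSigmaFinEquiv ⟨i, Fin.cast (if_pos hi).symm 0⟩, by simp⟩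

/-- The inserted units are scalars and `blockOf` identifies the remaining inputs with `I`, so
restriction merely forgets the coefficients at sets not contained in `I`. -/
theorem restrict_eq_zero_iff {n : ℕ} (I : Finset (Fin n)) (F : Carrier k d n) :
    (squareZeroComAugmented k d).restrict I F = 0 ↔
      F.1 = 0 ∧ ∀ x : Idx d n, x.1.1 ⊆ I → F.2 x = 0 := by
  have hu : (squareZeroComAugmented k d).restrict I F =
      comp (fun i => if i ∈ I then 1 else 0) F fun _ => (1, 0) :=
    congrArg (comp (k := k) (d := d) (fun i => if i ∈ I then 1 else 0) F)
      (funext (unitAt_eq I))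
  have hev : ∀ m a J, 0 < m → J.card ≤ m →
      ev m a J (comp (fun i => if i ∈ I then 1 else 0) F fun _ => (1, 0)) =
        ev m a (J.image blockOf) F := by
    intro m a J hm hJ
    rw [ev_comp _ _ _ _ _ _ hm hJ]
    simp [ev_scalar]
  rw [hu]
  change comp (fun i => if i ∈ I then 1 else 0) F (fun _ => (1, 0)) = (0 : Carrier k d _) ↔ _
  constructor
  · intro h
    refine ⟨?_, fun x hx => ?_⟩
    · have := congrArg Prod.fst h
      rw [comp_fst] at this
      exact Eq.trans (by simp) this
    · obtain ⟨J, hJ⟩ : ∃ J : Finset (Fin (∑ i, if i ∈ I then 1 else 0)),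
          J.image blockOf = x.1.1 := by
        classical
        refine (Finset.subset_set_image_iff (s := Set.univ)).1 ?_ |>.imp fun J h => h.2
        rw [Set.image_univ, range_blockOf]
        exact_mod_cast hx
      have hc : J.card = x.1.1.card := by
        rw [← hJ, Finset.card_image_of_injective _ (blockOf_injective I)]
      have h2 := hev x.1.1.card x.1.2 J (Finset.card_pos.2 x.2.1) hc.le
      rw [h, map_zero, hJ] at h2
      have h3 := congrArg TrivSqZeroExt.snd h2
      rw [snd_ev, coeff_idx] at h3
      exact h3.symm
  · rintro ⟨h1, h2⟩
    refine carrier_ext ?_ fun m a J hm hJ => ?_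
    · rw [comp_fst, h1, zero_mul]; rfl
    · rw [hev m a J hm hJ.le, map_zero, ev_eq_inl, h1, TrivSqZeroExt.inl_zero]
      rw [coeff]
      split_ifs with h
      · refine h2 ⟨(J.image blockOf, a), h.2⟩ ?_
        intro i hi
        obtain ⟨p, -, rfl⟩ := Finset.mem_image.1 hi
        have := Set.mem_range_self (f := blockOf (k' := fun i => if i ∈ I then 1 else 0)) p
        rwa [range_blockOf] at this
      · rfl

theorem mem_truncation_iff (m : ℕ) (F : Carrier k d (m + 1)) :
    F ∈ (squareZeroComAugmented k d).truncation (m + 1) (m + 1) ↔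
      F.1 = 0 ∧ ∀ x : Idx d (m + 1), x.1.1 ≠ Finset.univ → F.2 x = 0 := by
  refine ((UnitaryOperad.mem_truncation_succ_iff
    (squareZeroComAugmented k d).toUnitaryOperad le_rfl F).trans
    (forall₂_congr fun I _ => restrict_eq_zero_iff I F)).trans ?_
  constructor
  · intro h
    refine ⟨?_, fun x hx => ?_⟩
    · obtain ⟨I, -, hI⟩ := Finset.exists_subset_card_eq
        (s := (Finset.univ : Finset (Fin (m + 1)))) (n := m) (by simp)
      exact (h I hI).1
    · have hlt : x.1.1.card < m + 1 := by
        simpa using (Finset.card_lt_iff_ne_univ x.1.1).2 hx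
      obtain ⟨I, hI, hI'⟩ := Finset.exists_superset_card_eq (s := x.1.1) (n := m) (by omega)
        (by simp)
      exact (h I hI').2 x hI
  · rintro ⟨h1, h2⟩ I hI
    refine ⟨h1, fun x hx => h2 x ?_⟩
    rintro hu
    rw [hu, Finset.univ_subset_iff] at hx
    simp [hx] at hI

/-- The top truncation in arity `m + 1` consists of the functions supported on the full set of
inputs. -/
def truncationEquiv (m : ℕ) :
    (squareZeroComAugmented k d).truncation (m + 1) (m + 1) ≃ₗ[k] (Fin (d (m + 1)) → k) where
  toFun F a := Prod.snd (F.1 : Carrier k d (m + 1))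
    ⟨(Finset.univ, a), Finset.univ_nonempty, by simp⟩
  map_add' _ _ := rfl
  map_smul' _ _ := rfl
  invFun f := ⟨((0, fun x => if h : x.1.1 = Finset.univ then
      f ⟨x.1.2, by simpa [h] using x.2.2⟩ else 0) : Carrier k d (m + 1)),
    (mem_truncation_iff m _).2 ⟨rfl, fun x hx => dif_neg hx⟩⟩
  left_inv F := by
    obtain ⟨h1, h2⟩ := (mem_truncation_iff m _).1 F.2
    refine Subtype.ext (Prod.ext h1.symm (funext fun x => ?_))
    by_cases hx : x.1.1 = Finset.univ
    · refine (dif_pos hx).trans (congrArg (Prod.snd (F.1 : Carrier k d (m + 1))) ?_)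
      exact Subtype.ext (Prod.ext hx.symm rfl)
    · exact (dif_neg hx).trans (h2 x hx).symm
  right_inv f := by
    ext a
    exact dif_pos rfl

theorem signature_eq (n : ℕ+) : (squareZeroComAugmented k d).signature n = (d n : Cardinal) := by
  obtain ⟨n, hn⟩ := n
  obtain ⟨m, rfl⟩ := Nat.exists_eq_succ_of_ne_zero hn.ne'
  exact (truncationEquiv m).rank_eq.trans (rank_fin_fun _)

instance finite_idx (n : ℕ) : Finite (Idx d n) := by
  refine Finite.of_injective
    (β := (J : Finset (Fin n)) × Fin (d J.card)) (fun x => ⟨x.1.1, ⟨x.1.2, x.2.2⟩⟩) ?_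
  intro x y h
  obtain ⟨⟨⟨J, a⟩, hx⟩, ⟨J', b⟩, hy⟩ := x, y
  simp only [Sigma.mk.injEq] at h
  obtain ⟨rfl, h⟩ := h
  simp only [heq_eq_eq, Fin.mk.injEq] at h
  subst h
  rfl

theorem locallyFinite : (squareZeroComAugmented k d).LocallyFinite :=
  fun n => inferInstanceAs (Module.Finite k (Carrier k d n))

/-- Bases indexed by all sets of inputs, the empty set carrying one colour. -/
def optionIdxEquiv (h0 : d 0 = 1) (n : ℕ) :
    ((J : Finset (Fin n)) × Fin (d J.card)) ≃ Unit ⊕ Idx d n where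
  toFun x := if h : x.1.Nonempty then .inr ⟨(x.1, x.2), h, x.2.2⟩ else .inl ()
  invFun := Sum.elim (fun _ => ⟨∅, ⟨0, by simp [h0]⟩⟩) (fun x => ⟨x.1.1, ⟨x.1.2, x.2.2⟩⟩)
  left_inv := by
    rintro ⟨J, a⟩
    by_cases h : J.Nonempty
    · simp [h]
    · rw [Finset.not_nonempty_iff_eq_empty] at h
      subst h
      simp only [Finset.not_nonempty_empty, dite_false, Sum.elim_inl, Sigma.mk.injEq, heq_eq_eq,
        true_and]
      have := a.2
      simp only [Finset.card_empty, h0] at this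
      ext
      simp only
      omega
  right_inv := by
    rintro (_ | x)
    · simp
    · simp [x.2.1]

/-- The value `d 0` does not affect the operad; setting it to 1 lets the empty set account for the
scalar part. -/
theorem finrank_carrier (h0 : d 0 = 1) (n : ℕ) :
    Module.finrank k ((squareZeroComAugmented k d).carrier n) =
      ∑ m ∈ Finset.range (n + 1), n.choose m * d m := by
  classical
  have := Fintype.ofFinite (Idx d n)
  have h : Module.finrank k ((squareZeroComAugmented k d).carrier n) =
      Module.finrank k (Carrier k d n) := rfl
  rw [h, Module.finrank_prod, Module.finrank_self, Module.finrank_fintype_fun_eq_card]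
  have h2 := Fintype.card_congr (optionIdxEquiv h0 n)
  rw [Fintype.card_sum, Fintype.card_unit, Fintype.card_sigma] at h2
  rw [← h2]
  simp only [Fintype.card_fin]
  have h3 := Finset.sum_powerset_apply_card d (x := (Finset.univ : Finset (Fin n)))
  simpa using h3

end SquareZeroOperad

/-! ### Restrictions and truncations in unitary operads -/

namespace KOperad

theorem arityCast_eq_zero_iff {k : Type u} [Field k] (P : SymmOperad.{u, v} k) {m n : ℕ}
    (h : m = n) (θ : P.carrier m) : arityCast (P := P.carrier) h θ = 0 ↔ θ = 0 := by
  subst h; rfl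

end KOperad

theorem KOperad.arityCast_eq_iff {P : ℕ → Type v} {m n : ℕ} (h : m = n) (x : P m) (y : P n) :
    arityCast h x = y ↔ x = arityCast h.symm y := by
  subst h; rfl

theorem KOperad.arityCast_smul {k : Type u} [Field k] (P : SymmOperad.{u, v} k) {m n : ℕ}
    (h : m = n) (c : k) (θ : P.carrier m) :
    arityCast (P := P.carrier) h (c • θ) = c • arityCast (P := P.carrier) h θ := by
  subst h; rfl

namespace SymmOperad
variable {k : Type u} [Field k] (P : SymmOperad.{u, v} k)

theorem act_eq_zero_iff {n : ℕ} (σ : Equiv.Perm (Fin n)) (θ : P.carrier n) :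
    P.act σ θ = 0 ↔ θ = 0 := by
  refine ⟨fun h => ?_, fun h => by rw [h, map_zero]⟩
  have := P.act_mul σ σ⁻¹ θ
  rwa [h, map_zero, mul_inv_cancel, P.act_one] at this

theorem comp_eq_zero_of_smul {n : ℕ} {k₁ k₂ : Fin n → ℕ} (h : ∀ i, k₁ i = k₂ i) (θ : P.carrier n)
    (f : ∀ i, P.carrier (k₁ i)) (g : ∀ i, P.carrier (k₂ i)) (c : Fin n → k)
    (hg : ∀ i, g i = c i • arityCast (P := P.carrier) (h i) (f i)) (hf : P.comp k₁ θ f = 0) :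
    P.comp k₂ θ g = 0 := by
  obtain rfl : k₁ = k₂ := funext h
  obtain rfl : g = fun i => c i • f i := funext hg
  rw [MultilinearMap.map_smul_univ, hf, smul_zero]

theorem comp_ne_zero_of_arityCast_eq_one {N a : ℕ} (h : N = 1) (X : P.carrier N)
    (hX : arityCast (P := P.carrier) h X = P.one) {θ : P.carrier a} (hθ : θ ≠ 0) :
    P.comp (fun _ : Fin N => a) X (fun _ => θ) ≠ 0 := by
  subst h
  obtain rfl : X = P.one := hX
  intro h0
  have := P.one_comp θ
  rw [h0, (arityCast_eq_zero_iff P _ _).2 rfl] at this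
  exact hθ this.symm

end SymmOperad

namespace UnitaryOperad
variable {k : Type u} [Field k] (P : UnitaryOperad.{u, v} k)

/-- The operations `1₀` and `1₁`, extended by zero to all arities. -/
def unitOp : (m : ℕ) → P.carrier m
  | 0 => P.zeroUnit
  | 1 => P.one
  | _ + 2 => 0

theorem unitOp_ne_zero {m : ℕ} (h : m = 0) : P.unitOp m ≠ 0 := by
  subst h; exact P.zeroUnit_ne_zero

theorem exists_smul_unitOp {m : ℕ} (h : m = 0) (z : P.carrier m) : ∃ c : k, z = c • P.unitOp m := by
  subst h
  have : z ∈ Submodule.span k {P.zeroUnit} := by rw [P.span_zeroUnit]; trivial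
  obtain ⟨c, hc⟩ := Submodule.mem_span_singleton.1 this
  exact ⟨c, hc.symm⟩

theorem arityCast_eq_unitOp_iff {m n : ℕ} (h : m = n) (θ : P.carrier m) :
    arityCast (P := P.carrier) h θ = P.unitOp n ↔ θ = P.unitOp m := by
  subst h; rfl

theorem arityCast_unitOp {m n : ℕ} (h : m = n) :
    arityCast (P := P.carrier) h (P.unitOp m) = P.unitOp n := by
  subst h; rfl

theorem unitAt_eq_unitOp {n : ℕ} (I : Finset (Fin n)) (i : Fin n) :
    P.unitAt I i = P.unitOp (if i ∈ I then 1 else 0) := by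
  rw [unitAt]
  split
  · exact P.arityCast_unitOp (m := 1) _
  · exact P.arityCast_unitOp (m := 0) _

theorem comp_unitOp {a : ℕ} (ha : a ≤ 1) (l : Fin a → ℕ) :
    P.comp l (P.unitOp a) (fun j => P.unitOp (l j)) = P.unitOp (∑ j, l j) := by
  match a, ha with
  | 0, _ =>
    -- With no inputs, `l` may be taken constantly 1, and the right unit law applies.
    obtain rfl : l = fun _ => 1 := funext fun i => i.elim0
    exact (P.arityCast_eq_unitOp_iff (sum_one_arity 0) _).1 (P.comp_one P.zeroUnit)
  | 1, _ =>
    obtain ⟨q, rfl⟩ : ∃ q, l = fun _ => q :=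
      ⟨l 0, funext fun i => congrArg l (Subsingleton.elim i 0)⟩
    exact (P.arityCast_eq_unitOp_iff (sum_fin_one_arity q) _).1 (P.one_comp (P.unitOp q))

/-- Insertion of `unitOp` into all inputs; for `k'` with values in `{0, 1}` this restricts to the
inputs where `k'` is `1`. -/
def res {n : ℕ} (k' : Fin n → ℕ) : P.carrier n →ₗ[k] P.carrier (∑ i, k' i) where
  toFun θ := P.comp k' θ fun i => P.unitOp (k' i)
  map_add' _ _ := by simp
  map_smul' _ _ := by simp

theorem restrict_eq_res {n : ℕ} (I : Finset (Fin n)) (θ : P.carrier n) :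
    P.restrict I θ = P.res (fun i => if i ∈ I then 1 else 0) θ :=
  congrArg (P.comp (fun i => if i ∈ I then 1 else 0) θ) (funext (P.unitAt_eq_unitOp I))

theorem res_unitOp {a : ℕ} (ha : a ≤ 1) (l : Fin a → ℕ) :
    P.res l (P.unitOp a) = P.unitOp (∑ j, l j) := P.comp_unitOp ha l

/-- Associativity, stated for vanishing only: the two sides live in arities that are equal but not
definitionally so, and vanishing needs no transport. -/
theorem comp_res {n : ℕ} {k' : Fin n → ℕ} (θ : P.carrier n) (θ' : ∀ i, P.carrier (k' i))
    (q : Fin (∑ i, k' i) → ℕ) :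
    P.res q (P.comp k' θ θ') = 0 ↔
      P.comp (fun i => ∑ j, q (finSigmaFinEquiv ⟨i, j⟩)) θ
        (fun i => P.res (fun j => q (finSigmaFinEquiv ⟨i, j⟩)) (θ' i)) = 0 := by
  have h := P.comp_assoc k' (fun i j => q (finSigmaFinEquiv ⟨i, j⟩)) θ θ'
    (fun i j => P.unitOp (q (finSigmaFinEquiv ⟨i, j⟩)))
  have hq : (fun p : Fin (∑ i, k' i) => q (finSigmaFinEquiv
      ⟨(finSigmaFinEquiv.symm p).1, (finSigmaFinEquiv.symm p).2⟩)) = q :=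
    funext fun p => congrArg q (Equiv.apply_symm_apply finSigmaFinEquiv p)
  have h2 : ∀ q' : Fin (∑ i, k' i) → ℕ, q' = q → (P.res q (P.comp k' θ θ') = 0 ↔
      P.comp q' (P.comp k' θ θ') (fun p => P.unitOp (q' p)) = 0) := by
    rintro _ rfl; rfl
  rw [h2 _ hq]
  rw [← arityCast_eq_zero_iff P.toSymmOperad (sum_sum_arity fun i j => q (finSigmaFinEquiv ⟨i, j⟩)),
    ← h]
  rfl

theorem res_res_eq_zero_iff {n : ℕ} {k' : Fin n → ℕ} (hk' : ∀ i, k' i ≤ 1) (θ : P.carrier n)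
    (q : Fin (∑ i, k' i) → ℕ) :
    P.res q (P.res k' θ) = 0 ↔ P.res (fun i => ∑ j, q (finSigmaFinEquiv ⟨i, j⟩)) θ = 0 := by
  refine (P.comp_res θ _ q).trans ?_
  simp only [P.res_unitOp (hk' _)]
  rfl

/-- Up to transport of arity, the smaller restriction factors through the larger one. -/
theorem res_eq_zero_of_le {n : ℕ} {k₁ k₂ : Fin n → ℕ} (h : ∀ i, k₂ i ≤ k₁ i) (h₁ : ∀ i, k₁ i ≤ 1)
    {θ : P.carrier n} (hθ : P.res k₁ θ = 0) : P.res k₂ θ = 0 := by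
  have h2 := P.res_res_eq_zero_iff h₁ θ (fun p => k₂ (blockOf p))
  rw [hθ, map_zero] at h2
  have h3 : (fun i => ∑ j : Fin (k₁ i), k₂ (blockOf (finSigmaFinEquiv ⟨i, j⟩))) = k₂ := by
    funext i
    have := h i
    have := h₁ i
    simp only [blockOf_finSigmaFinEquiv, Finset.sum_const, Finset.card_univ, Fintype.card_fin,
      smul_eq_mul]
    interval_cases k₁ i
    · omega
    · omega
  rw [h3] at h2
  exact h2.1 rfl

theorem res_one_eq_zero_iff {n : ℕ} (θ : P.carrier n) : P.res (fun _ => 1) θ = 0 ↔ θ = 0 := by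
  rw [← arityCast_eq_zero_iff P.toSymmOperad (sum_one_arity n)]
  exact iff_of_eq (congrArg (· = 0) (P.comp_one θ))

theorem res_act_eq_zero_iff {n : ℕ} (k' : Fin n → ℕ) (σ : Equiv.Perm (Fin n)) (θ : P.carrier n) :
    P.res k' (P.act σ θ) = 0 ↔ P.res (fun i => k' (σ.symm i)) θ = 0 := by
  have h := P.comp_equivariant k' σ (fun _ => 1) θ (fun i => P.unitOp (k' i))
  simp only [P.act_one] at h
  refine (iff_of_eq (congrArg (· = 0) h)).trans ?_
  rw [P.act_eq_zero_iff, arityCast_eq_zero_iff]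
  rfl

theorem mem_truncation_self_iff {n : ℕ} (θ : P.carrier n) :
    θ ∈ P.truncation n n ↔
      ∀ I : Finset (Fin n), I.card < n → P.res (fun i => if i ∈ I then 1 else 0) θ = 0 := by
  cases n with
  | zero => simp [truncation]
  | succ m =>
    rw [P.mem_truncation_succ_iff le_rfl]
    simp only [restrict_eq_res]
    constructor
    · intro h I hI
      obtain ⟨J, hJ, hJ'⟩ := Finset.exists_superset_card_eq (s := I) (n := m) (by omega) (by simp)
      refine P.res_eq_zero_of_le (fun i => ?_) (fun i => ?_) (h J hJ')
      · by_cases hi : i ∈ I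
        · simp [hi, hJ hi]
        · simp [hi]
      · split <;> simp
    · intro h I hI
      exact h I (by omega)

theorem res_eq_zero_of_mem_truncation {n : ℕ} {θ : P.carrier n} (hθ : θ ∈ P.truncation n n)
    {k' : Fin n → ℕ} (hk' : ∀ i, k' i ≤ 1) {i : Fin n} (hi : k' i = 0) : P.res k' θ = 0 := by
  refine P.res_eq_zero_of_le (fun j => ?_) (fun j => ?_)
    ((P.mem_truncation_self_iff θ).1 hθ (Finset.univ.erase i) ?_)
  · by_cases hj : j = i
    · simp [hj, hi]
    · simpa [hj] using hk' j
  · split <;> simp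
  · rw [Finset.card_erase_of_mem (Finset.mem_univ i)]
    have := i.pos
    simp only [Finset.card_univ, Fintype.card_fin]
    omega

theorem sum_ite_mem_eq_card {n : ℕ} (I : Finset (Fin n)) :
    ∑ i, (if i ∈ I then 1 else 0) = I.card := by simp

/-- By induction on the size of `I`: once all smaller restrictions vanish, the restriction to `I`
lies in the top truncation of its arity, which is zero from `K` on. The case of all inputs gives `θ`
itself. -/
theorem eq_zero_of_forall_res_eq_zero {K : ℕ} (hK : ∀ j, K ≤ j → P.truncation j j = ⊥) {n : ℕ}
    {θ : P.carrier n}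
    (h : ∀ I : Finset (Fin n), I.card < K → P.res (fun i => if i ∈ I then 1 else 0) θ = 0) :
    θ = 0 := by
  suffices H : ∀ (c : ℕ) (I : Finset (Fin n)), I.card = c →
      P.res (fun i => if i ∈ I then 1 else 0) θ = 0 by
    have aux : ∀ q : Fin n → ℕ, q = (fun _ => 1) → P.res q θ = 0 → θ = 0 := by
      rintro _ rfl
      exact (P.res_one_eq_zero_iff θ).1
    exact aux _ (by simp) (H _ Finset.univ rfl)
  intro c
  induction c using Nat.strong_induction_on with
  | _ c ih =>
    intro I hI
    by_cases hc : c < K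
    · exact h I (hI ▸ hc)
    have hs := sum_ite_mem_eq_card I
    rw [← Submodule.mem_bot k, ← hK _ (by rw [hs, hI]; omega), mem_truncation_self_iff]
    intro L hL
    replace hL : L.card < c := hL.trans_eq (hs.trans hI)
    rw [P.res_res_eq_zero_iff (fun i => by split <;> simp)]
    -- Restricting to `I` and then to `L` is restricting to the inputs where `q` is 1, a set with as
    -- many elements as `L`.
    set q : Fin n → ℕ := fun i => ∑ j : Fin (if i ∈ I then 1 else 0),
      if finSigmaFinEquiv ⟨i, j⟩ ∈ L then 1 else 0 with hq
    have hsum : ∑ i, q i = L.card := by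
      rw [← sum_ite_mem_eq_card L, ← Equiv.sum_comp finSigmaFinEquiv, Fintype.sum_sigma]
    have hq1 : ∀ i, q i ≤ 1 := by
      intro i
      refine (Finset.sum_le_card_nsmul _ _ 1 fun j _ => by split <;> simp).trans ?_
      simp only [Finset.card_univ, Fintype.card_fin, smul_eq_mul, mul_one]
      split <;> simp
    have hq2 : q = fun i => if i ∈ Finset.univ.filter (fun i => q i = 1) then 1 else 0 := by
      funext i
      have := hq1 i
      by_cases h1 : q i = 1
      · simp [h1]
      · simp [h1]; omega
    rw [hq2] at hsum ⊢
    refine ih _ ?_ _ rfl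
    rw [← sum_ite_mem_eq_card, hsum]
    exact hL

theorem finrank_le (hP : P.LocallyFinite) {K : ℕ} (hK : ∀ j, K ≤ j → P.truncation j j = ⊥)
    (n : ℕ) : Module.finrank k (P.carrier n) ≤
      ∑ m ∈ Finset.range (n + 1),
        n.choose m * if m < K then Module.finrank k (P.carrier m) else 0 := by
  have := fun n => hP n
  let f : P.carrier n →ₗ[k] (I : {I : Finset (Fin n) // I.card < K}) →
      P.carrier (∑ i, if i ∈ I.1 then 1 else 0) :=
    LinearMap.pi fun I => P.res fun i => if i ∈ I.1 then 1 else 0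
  have hf : Function.Injective f := by
    rw [← LinearMap.ker_eq_bot, LinearMap.ker_eq_bot']
    intro θ hθ
    exact P.eq_zero_of_forall_res_eq_zero hK fun I hI => congrFun hθ ⟨I, hI⟩
  refine (LinearMap.finrank_le_finrank_of_injective hf).trans (le_of_eq ?_)
  rw [Module.finrank_pi_fintype]
  rw [Finset.sum_congr rfl fun I _ =>
    congrArg (fun m => Module.finrank k (P.carrier m)) (sum_ite_mem_eq_card I.1)]
  have h3 := Finset.sum_powerset_apply_card
    (fun m => if m < K then Module.finrank k (P.carrier m) else 0)
    (x := (Finset.univ : Finset (Fin n)))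
  simp only [Finset.powerset_univ, Finset.card_univ, Fintype.card_fin, smul_eq_mul] at h3
  rw [← h3, ← Finset.sum_filter]
  exact (Finset.sum_subtype (p := fun I : Finset (Fin n) => I.card < K) _ (fun I => by simp)
    fun I => Module.finrank k (P.carrier I.card)).symm

end UnitaryOperad

/-! ### Lower bounds for dimensions in 2-unitary operads -/

namespace TwoUnitaryOperad
variable {k : Type u} [Field k] (P : TwoUnitaryOperad.{u, v} k)

/-- Since `f 1` is a nonzero multiple of 1₀, the right unit law makes the composite a nonzero
multiple of `f 0`. -/
theorem comp_twoUnit_ne_zero {k' : Fin 2 → ℕ} (f : ∀ i, P.carrier (k' i)) (h1 : k' 1 = 0)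
    (hf0 : f 0 ≠ 0) (hf1 : f 1 ≠ 0) : P.comp k' P.twoUnit f ≠ 0 := by
  intro h0
  have hassoc := P.comp_assoc ![1, 0] (fun _ _ => k' 0) P.twoUnit (P.pair P.one P.zeroUnit)
    (fun _ _ => f 0)
  refine P.comp_ne_zero_of_arityCast_eq_one (Fin.sum_univ_two ![1, 0]) _ P.right_unit hf0
    ((arityCast_eq_zero_iff P.toSymmOperad _ _).1 (hassoc.symm.trans ?_))
  obtain ⟨c, hc⟩ := P.exists_smul_unitOp h1 (f 1)
  have hc0 : c ≠ 0 := by rintro rfl; exact hf1 (by rw [hc, zero_smul])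
  have harity : ∀ i, k' i = ∑ _j : Fin (![1, 0] i), k' 0 :=
    Fin.forall_fin_two.2 ⟨(Fin.sum_univ_one fun _ => k' 0).symm, h1⟩
  refine P.comp_eq_zero_of_smul harity _ f _ ![1, c⁻¹] (Fin.forall_fin_two.2 ⟨?_, ?_⟩) h0
  · exact ((arityCast_eq_iff _ _ _).1 (P.one_comp (f 0))).trans (one_smul k _).symm
  · have h2 : P.comp (fun _ : Fin 0 => k' 0) P.zeroUnit (fun _ => f 0) =
        P.unitOp (∑ _ : Fin 0, k' 0) := by
      rw [← P.comp_unitOp (a := 0) (by omega)]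
      exact congrArg (P.comp (fun _ : Fin 0 => k' 0) P.zeroUnit) (funext fun i => i.elim0)
    refine h2.trans ?_
    rw [hc, arityCast_smul, P.arityCast_unitOp]
    change _ = c⁻¹ • c • P.unitOp (∑ _ : Fin 0, k' 0)
    rw [smul_smul, inv_mul_cancel₀ hc0, one_smul]

/-- The operation `1₂ ∘ (θ, w)`. -/
def juxt {a b : ℕ} (θ : P.carrier a) (w : P.carrier b) : P.carrier (∑ i, ![a, b] i) :=
  P.comp ![a, b] P.twoUnit (P.pair θ w)

/-- Plugging all inputs of `w` turns it into a nonzero multiple of 1₀, which 1₂ absorbs. -/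
theorem res_juxt_ne_zero {a b : ℕ} (θ : P.carrier a) (w : P.carrier b)
    {q : Fin (∑ i, ![a, b] i) → ℕ}
    (hθ : P.res (fun j : Fin a => q (finSigmaFinEquiv ⟨0, j⟩)) θ ≠ 0)
    (hq : ∀ j : Fin b, q (finSigmaFinEquiv ⟨1, j⟩) = 0)
    (hw : P.res (fun _ => 0) w ≠ 0) : P.res q (P.juxt θ w) ≠ 0 := by
  intro h0
  refine P.comp_twoUnit_ne_zero _ ?_ hθ ?_ ((P.comp_res P.twoUnit (P.pair θ w) q).1 h0)
  · exact Finset.sum_eq_zero fun j _ => hq j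
  · have : (fun j : Fin b => q (finSigmaFinEquiv ⟨1, j⟩)) = fun _ => 0 := funext hq
    have aux : ∀ r : Fin b → ℕ, r = (fun _ => 0) → P.res r w ≠ 0 := by
      rintro _ rfl
      exact hw
    exact aux _ this

theorem res_juxt_eq_zero {a b : ℕ} (θ : P.carrier a) (w : P.carrier b)
    {q : Fin (∑ i, ![a, b] i) → ℕ}
    (hθ : P.res (fun j : Fin a => q (finSigmaFinEquiv ⟨0, j⟩)) θ = 0) :
    P.res q (P.juxt θ w) = 0 :=
  (P.comp_res P.twoUnit (P.pair θ w) q).2 (MultilinearMap.map_coord_zero _ (0 : Fin 2) hθ)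

/-- Iterating 1₂ on identities gives such an operation in every arity. -/
theorem exists_res_zero_ne_zero (m : ℕ) : ∃ w : P.carrier m, P.res (fun _ => 0) w ≠ 0 := by
  induction m with
  | zero =>
    refine ⟨P.zeroUnit, ?_⟩
    have := P.res_unitOp (a := 0) (by omega) (fun _ => 0)
    exact this ▸ P.unitOp_ne_zero (by simp)
  | succ m ih =>
    obtain ⟨w, hw⟩ := ih
    have h1 : P.res (fun _ => 0) P.one ≠ 0 := by
      have := P.res_unitOp (a := 1) (by omega) (fun _ => 0)
      exact this ▸ P.unitOp_ne_zero (by simp)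
    have h2 : P.res (fun _ => 0) (P.juxt w P.one) ≠ 0 :=
      P.res_juxt_ne_zero w P.one hw (fun _ => rfl) h1
    have h3 : ∑ i, ![m, 1] i = m + 1 := Fin.sum_univ_two _
    exact h3 ▸ ⟨_, h2⟩

/-- For each `a`-element set `I` of inputs, attach `θ` to the inputs in `I` and `w` to the others.
Restriction to an `a`-element set `J` kills all of these except the one with `I = J`, so they are
independent. -/
theorem choose_le_finrank (hP : P.LocallyFinite) {a : ℕ} (ha : P.truncation a a ≠ ⊥) (b : ℕ) :
    (a + b).choose a ≤ Module.finrank k (P.carrier (a + b)) := by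
  obtain ⟨θ, hθ, hθ0⟩ := Submodule.exists_mem_ne_zero_of_ne_bot ha
  obtain ⟨w, hw⟩ := P.exists_res_zero_ne_zero b
  have hN' : ∑ i, ![a, b] i = a + b := Fin.sum_univ_two _
  rw [← hN']
  have := hP (∑ i, ![a, b] i)
  let A : Finset (Fin (∑ i, ![a, b] i)) :=
    Finset.univ.image fun j : Fin a => finSigmaFinEquiv (⟨0, j⟩ : (i : Fin 2) × Fin (![a, b] i))
  have hinj : Function.Injective fun j : Fin a =>
      finSigmaFinEquiv (⟨0, j⟩ : (i : Fin 2) × Fin (![a, b] i)) := by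
    intro x y h
    exact eq_of_heq (Sigma.mk.inj (finSigmaFinEquiv.injective h)).2
  have hA : A.card = a := by
    rw [Finset.card_image_of_injective _ hinj, Finset.card_univ, Fintype.card_fin]
  have hA1 : ∀ j : Fin b,
      finSigmaFinEquiv (⟨1, j⟩ : (i : Fin 2) × Fin (![a, b] i)) ∉ A := by
    intro j hj
    obtain ⟨x, -, hx⟩ := Finset.mem_image.1 hj
    exact absurd (Sigma.mk.inj (finSigmaFinEquiv.injective hx)).1 (by decide)
  have hσ : ∀ I : {I : Finset (Fin (∑ i, ![a, b] i)) // I.card = a},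
      ∃ σ : Equiv.Perm (Fin (∑ i, ![a, b] i)), I.1.map σ.toEmbedding = A := by
    intro I
    have e : {x // x ∈ I.1} ≃ {x // x ∈ A} := Finset.equivOfCardEq (I.2.trans hA.symm)
    refine ⟨e.extendSubtype, Finset.eq_of_subset_of_card_le ?_ ?_⟩
    · intro x hx
      obtain ⟨y, hy, rfl⟩ := Finset.mem_map.1 hx
      exact e.extendSubtype_mem y hy
    · rw [Finset.card_map, hA, I.2]
  choose σ hσ using hσ
  let v : {I : Finset (Fin (∑ i, ![a, b] i)) // I.card = a} → P.carrier (∑ i, ![a, b] i) :=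
    fun I => P.act (σ I) (P.juxt θ w)
  have hv : ∀ I J : {I : Finset (Fin (∑ i, ![a, b] i)) // I.card = a},
      P.res (fun i => if i ∈ J.1 then 1 else 0) (v I) = 0 ↔ I ≠ J := by
    intro I J
    rw [P.res_act_eq_zero_iff]
    constructor
    · rintro h rfl
      have hmem : ∀ i, (σ I).symm i ∈ I.1 ↔ i ∈ A := by
        intro i
        rw [← hσ I, Finset.mem_map_equiv]
      refine P.res_juxt_ne_zero θ w ?_ ?_ hw h
      · have aux : ∀ r : Fin a → ℕ, r = (fun _ => 1) → P.res r θ ≠ 0 := by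
          rintro _ rfl
          exact fun h => hθ0 ((P.res_one_eq_zero_iff θ).1 h)
        refine aux _ (funext fun j => if_pos ((hmem _).2 ?_))
        exact Finset.mem_image_of_mem _ (Finset.mem_univ j)
      · intro j
        exact if_neg (fun h => hA1 j ((hmem _).1 h))
    · intro hIJ
      -- The input `x` of `θ` is plugged by 1₀, and `θ` vanishes under every proper restriction.
      obtain ⟨x, hxI, hxJ⟩ : ∃ x ∈ I.1, x ∉ J.1 := by
        by_contra! h
        exact hIJ (Subtype.ext (Finset.eq_of_subset_of_card_le h (by rw [I.2, J.2])))
      have hx : σ I x ∈ A := by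
        rw [← hσ I]
        exact Finset.mem_map_of_mem _ hxI
      obtain ⟨j, -, hj⟩ := Finset.mem_image.1 hx
      refine P.res_juxt_eq_zero θ w (P.res_eq_zero_of_mem_truncation hθ
        (fun i => by split <;> simp) (i := j) ?_)
      refine if_neg ?_
      rw [hj, Equiv.symm_apply_apply]
      exact hxJ
  have hli : LinearIndependent k v := by
    rw [Fintype.linearIndependent_iff]
    intro c hc J
    have h := congrArg (P.res fun i => if i ∈ J.1 then 1 else 0) hc
    rw [map_sum, map_zero, Finset.sum_eq_single J] at h
    · rw [map_smul] at h
      exact (smul_eq_zero.1 h).resolve_right fun h => (hv J J).1 h rfl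
    · intro I _ hI
      rw [map_smul, (hv I J).2 hI, smul_zero]
    · simp
  have h := hli.fintype_card_le_finrank
  rwa [Fintype.card_finset_len, Fintype.card_fin] at h

theorem one_le_finrank (hP : P.LocallyFinite) (n : ℕ) :
    1 ≤ Module.finrank k (P.carrier n) := by
  -- The zeroth truncation is everything, so `θ` may be a nonzero element of arity 0.
  have h := P.choose_le_finrank hP (a := 0)
    (fun h => P.zeroUnit_ne_zero ((Submodule.mem_bot k).1 (h ▸ trivial))) n
  rwa [Nat.choose_zero_right, zero_add] at h

end TwoUnitaryOperad

/-! ### The 2-unit of a `Com`-augmented operad -/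

namespace ComAugmentedOperad
variable {k : Type u} [Field k] (P : ComAugmentedOperad.{u, v} k)

/-- The image in `P(n)` of the generator of `Com(n)`. -/
def unit (n : ℕ) : P.carrier n := P.fromCom.map (n := n) (1 : k)

theorem arityCast_unit {m n : ℕ} (h : m = n) :
    arityCast (P := P.carrier) h (P.unit m) = P.unit n := by
  subst h; rfl

theorem comp_unit {n : ℕ} (k' : Fin n → ℕ) :
    P.comp k' (P.unit n) (fun i => P.unit (k' i)) = P.unit (∑ i, k' i) := by
  refine (P.fromCom.map_comp k' (1 : k) fun _ => (1 : k)).symm.trans (congrArg _ ?_)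
  change (1 : k) * ∏ _i : Fin n, (1 : k) = 1
  simp

theorem unit_zero : P.unit 0 = P.zeroUnit := P.fromCom_zeroUnit

theorem unit_one : P.unit 1 = P.one := P.fromCom.map_one

theorem comp₂_unit (m n : ℕ) :
    P.comp₂ (P.unit 2) (P.unit m) (P.unit n) = P.unit (m + n) := by
  have h : P.pair (P.unit m) (P.unit n) = fun i => P.unit (![m, n] i) :=
    funext (Fin.forall_fin_two.2 ⟨rfl, rfl⟩)
  rw [SymmOperad.comp₂, h, P.comp_unit]
  exact P.arityCast_unit _

/-- A `Com`-augmented operad is 2-unitary. -/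
def toTwoUnitaryOperad : TwoUnitaryOperad.{u, v} k where
  toUnitaryOperad := P.toUnitaryOperad
  twoUnit := P.unit 2
  left_unit := by
    rw [← unit_zero, ← unit_one]
    exact P.comp₂_unit 0 1
  right_unit := by
    rw [← unit_zero, ← unit_one]
    exact P.comp₂_unit 1 0

end ComAugmentedOperad

/-! ### The gap between exponents 1 and 2 -/

open Filter Topology

/-- Makes polynomial factors in the dimensions invisible to the exponent. -/
theorem ENNReal.tendsto_natCast_rpow_one_div :
    Tendsto (fun n : ℕ => (n : ℝ≥0∞) ^ (1 / (n : ℝ))) atTop (𝓝 1) := by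
  have h := ENNReal.tendsto_ofReal (tendsto_rpow_div.comp tendsto_natCast_atTop_atTop)
  rw [ENNReal.ofReal_one] at h
  refine h.congr' ?_
  filter_upwards [eventually_gt_atTop 0] with n hn
  rw [Function.comp_apply, ← ENNReal.ofReal_rpow_of_pos (by exact_mod_cast hn),
    ENNReal.ofReal_natCast]

namespace TwoUnitaryOperad
variable {k : Type u} [Field k] (P : TwoUnitaryOperad.{u, v} k)

theorem one_le_exponent (hP : P.LocallyFinite) : 1 ≤ P.exponent := by
  refine le_limsup_of_frequently_le (Frequently.of_forall fun n => ?_)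
  rw [← ENNReal.one_rpow (1 / (n : ℝ))]
  refine ENNReal.rpow_le_rpow ?_ (by positivity)
  exact_mod_cast P.one_le_finrank hP n

theorem exponent_le_one (hP : P.LocallyFinite) {K : ℕ}
    (hK : ∀ j, K ≤ j → P.truncation j j = ⊥) : P.exponent ≤ 1 := by
  set D : ℕ := ∑ m ∈ Finset.range K, Module.finrank k (P.carrier m) with hD
  have hdim : ∀ n, Module.finrank k (P.carrier n) ≤ D * (n + 1) ^ K := by
    intro n
    refine (P.finrank_le hP hK n).trans ?_
    simp only [mul_ite, mul_zero]
    rw [← Finset.sum_filter, hD, Finset.sum_mul]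
    refine (Finset.sum_le_sum_of_subset (t := Finset.range K) fun m hm => ?_).trans
      (Finset.sum_le_sum fun m hm => ?_)
    · simpa using (Finset.mem_filter.1 hm).2
    · rw [mul_comm]
      refine Nat.mul_le_mul_left _ ((Nat.choose_le_pow n m).trans ?_)
      exact (Nat.pow_le_pow_left n.le_succ m).trans
        (Nat.pow_le_pow_right n.succ_pos (Finset.mem_range.1 hm).le)
  -- The power 2K + 1 suffices: for n ≥ D and n ≥ 2, both D ≤ n and n + 1 ≤ n² hold.
  have hlim : Tendsto (fun n : ℕ => ((n : ℝ≥0∞) ^ (1 / (n : ℝ))) ^ (2 * K + 1)) atTop (𝓝 1) := by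
    simpa using ENNReal.Tendsto.pow (n := 2 * K + 1) ENNReal.tendsto_natCast_rpow_one_div
  rw [← hlim.limsup_eq]
  refine limsup_le_limsup ?_
  filter_upwards [eventually_ge_atTop D, eventually_ge_atTop 2] with n hn hn2
  rw [← ENNReal.rpow_natCast, ← ENNReal.rpow_mul, mul_comm (1 / (n : ℝ)), ENNReal.rpow_mul,
    ENNReal.rpow_natCast]
  refine ENNReal.rpow_le_rpow ?_ (by positivity)
  have h : Module.finrank k (P.carrier n) ≤ n ^ (2 * K + 1) := by
    refine (hdim n).trans ?_
    rw [pow_succ', pow_mul]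
    exact Nat.mul_le_mul hn (Nat.pow_le_pow_left (by nlinarith) K)
  exact_mod_cast h

theorem two_le_exponent (hP : P.LocallyFinite)
    (h : ∀ K, ∃ j, K ≤ j ∧ P.truncation j j ≠ ⊥) : 2 ≤ P.exponent := by
  refine le_of_forall_lt fun c hc => ?_
  obtain ⟨c', hc', hc2⟩ := exists_between hc
  refine hc'.trans_le ?_
  have hlim : Tendsto (fun n : ℕ => 2 / (n : ℝ≥0∞) ^ (1 / (n : ℝ))) atTop (𝓝 2) := by
    simpa using ENNReal.Tendsto.const_div (a := 2) ENNReal.tendsto_natCast_rpow_one_div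
      (Or.inl ENNReal.one_ne_top)
  have hfreq : ∃ᶠ n : ℕ in atTop, 2 / (n : ℝ≥0∞) ^ (1 / (n : ℝ)) ≤
      ((Module.finrank k (P.carrier n) : ℕ) : ℝ≥0∞) ^ (1 / (n : ℝ)) := by
    refine frequently_atTop.2 fun N => ?_
    -- Asking for `N + 1` makes `j` positive, as the bound on the central binomial coefficient
    -- requires. In arity 2j it gives 4^j ≤ 2j · dim, whose 2j-th root is the claim.
    obtain ⟨j, hj, hj0⟩ := h (N + 1)
    refine ⟨j + j, by omega, ?_⟩
    have h1 : 4 ^ j ≤ (j + j) * Module.finrank k (P.carrier (j + j)) := by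
      refine (Nat.four_pow_le_two_mul_self_mul_centralBinom j (by omega)).trans ?_
      rw [two_mul]
      refine Nat.mul_le_mul_left _ ?_
      rw [Nat.centralBinom, two_mul]
      exact P.choose_le_finrank hP hj0 j
    refine ENNReal.div_le_of_le_mul' ?_
    rw [← ENNReal.mul_rpow_of_nonneg _ _ (by positivity)]
    have h2 : ((2 : ℝ≥0∞) ^ (j + j)) ^ (1 / ((j + j : ℕ) : ℝ)) = 2 := by
      rw [one_div]
      exact ENNReal.pow_rpow_inv_natCast (by omega) 2
    rw [← h2]
    refine ENNReal.rpow_le_rpow ?_ (by positivity)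
    rw [← two_mul, pow_mul]
    rw [← two_mul] at h1
    norm_num
    exact_mod_cast h1
  exact le_limsup_of_frequently_le ((hfreq.and_eventually (hlim.eventually_const_lt hc2)).mono
    fun n hn => hn.2.le.trans hn.1)

theorem exponent_mem (hP : P.LocallyFinite) : P.exponent ∈ ({1} ∪ Set.Icc 2 ∞ : Set ℝ≥0∞) := by
  by_cases h : ∃ K, ∀ j, K ≤ j → P.truncation j j = ⊥
  · obtain ⟨K, hK⟩ := h
    exact Or.inl (le_antisymm (P.exponent_le_one hP hK) (P.one_le_exponent hP))
  · push Not at h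
    exact Or.inr ⟨P.two_le_exponent hP h, le_top⟩

end TwoUnitaryOperad

/-! ### Realising every admissible exponent -/

namespace SquareZeroOperad
variable (k : Type u) [Field k]

theorem exponent_eq_one :
    (squareZeroComAugmented k fun m => if m = 0 then 1 else 0).exponent = 1 := by
  rw [SymmOperad.exponent]
  simp only [finrank_carrier (d := fun m => if m = 0 then 1 else 0) rfl]
  simp

theorem exponent_eq_top : (squareZeroComAugmented k fun m => m ^ m).exponent = ∞ := by
  rw [SymmOperad.exponent]
  simp only [finrank_carrier (d := fun m => m ^ m) rfl]
  refine Tendsto.limsup_eq (tendsto_nhds_top_mono ENNReal.tendsto_nat_nhds_top ?_)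
  filter_upwards [eventually_gt_atTop 0] with n hn
  rw [one_div, ENNReal.le_rpow_inv_iff (by exact_mod_cast hn), ENNReal.rpow_natCast]
  -- The top term alone makes the n-th root at least n.
  have h : n.choose n * n ^ n ≤ ∑ m ∈ Finset.range (n + 1), n.choose m * m ^ m :=
    Finset.single_le_sum (f := fun m => n.choose m * m ^ m) (fun _ _ => Nat.zero_le _)
      (Finset.self_mem_range_succ n)
  rw [Nat.choose_self, one_mul] at h
  exact_mod_cast h

theorem exponent_eq_ofReal {r : ℝ} (hr : 2 ≤ r) :
    (squareZeroComAugmented k fun m => ⌊(r - 1) ^ m⌋₊).exponent = ENNReal.ofReal r := by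
  rw [SymmOperad.exponent]
  simp only [finrank_carrier (d := fun m => ⌊(r - 1) ^ m⌋₊) (by simp)]
  set D : ℕ → ℕ := fun n => ∑ m ∈ Finset.range (n + 1), n.choose m * ⌊(r - 1) ^ m⌋₊ with hD
  have hsum : ∀ n : ℕ, r ^ n = ∑ m ∈ Finset.range (n + 1), (n.choose m : ℝ) * (r - 1) ^ m := by
    intro n
    have := add_pow (r - 1) 1 n
    simp only [sub_add_cancel, one_pow, mul_one] at this
    rw [this]
    exact Finset.sum_congr rfl fun _ _ => mul_comm _ _
  have hone : ∀ m : ℕ, 1 ≤ (r - 1) ^ m := fun m => one_le_pow₀ (by linarith)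
  have hle : ∀ n, (D n : ℝ) ≤ r ^ n := by
    intro n
    rw [hsum, hD]
    push_cast
    gcongr with m
    exact Nat.floor_le (by linarith [hone m])
  have hge : ∀ n, 2⁻¹ * r ^ n ≤ (D n : ℝ) := by
    intro n
    rw [hsum, hD, Finset.mul_sum]
    push_cast
    refine Finset.sum_le_sum fun m _ => ?_
    have h1 := Nat.lt_floor_add_one ((r - 1) ^ m)
    have h2 : (1 : ℝ) ≤ ⌊(r - 1) ^ m⌋₊ := by
      exact_mod_cast Nat.le_floor (by exact_mod_cast hone m)
    -- A number that is at least 1 is less than twice its floor; this is where r ≥ 2 enters. Hence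
    -- the dimensions lie between rⁿ/2 and rⁿ.
    have h3 : 2⁻¹ * (r - 1) ^ m ≤ ⌊(r - 1) ^ m⌋₊ := by linarith
    have h4 : (0 : ℝ) ≤ n.choose m := Nat.cast_nonneg _
    nlinarith
  have hinv : Tendsto (fun n : ℕ => 1 / (n : ℝ)) atTop (𝓝 0) := tendsto_one_div_atTop_nhds_zero_nat
  have hlow : Tendsto (fun n : ℕ => (2⁻¹ : ℝ) ^ (1 / (n : ℝ)) * r) atTop (𝓝 r) := by
    have := (((Real.continuousAt_const_rpow (a := (2⁻¹ : ℝ)) (b := 0) (by norm_num)).tendsto).comp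
      hinv).mul_const r
    simpa using this
  have hroot : ∀ n : ℕ, 0 < n → (r ^ n) ^ (1 / (n : ℝ)) = r := by
    intro n hn
    rw [one_div]
    exact Real.pow_rpow_inv_natCast (by linarith) hn.ne'
  have hreal : Tendsto (fun n : ℕ => (D n : ℝ) ^ (1 / (n : ℝ))) atTop (𝓝 r) := by
    refine tendsto_of_tendsto_of_tendsto_of_le_of_le' hlow tendsto_const_nhds ?_ ?_
    · filter_upwards [eventually_gt_atTop 0] with n hn
      refine (congrArg (2⁻¹ ^ (1 / (n : ℝ)) * ·) (hroot n hn)).symm.trans_le ?_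
      rw [← Real.mul_rpow (by norm_num) (by positivity)]
      exact Real.rpow_le_rpow (by positivity) (hge n) (by positivity)
    · filter_upwards [eventually_gt_atTop 0] with n hn
      refine le_of_le_of_eq ?_ (hroot n hn)
      exact Real.rpow_le_rpow (by positivity) (hle n) (by positivity)
  refine Tendsto.limsup_eq ((ENNReal.tendsto_ofReal hreal).congr fun n => ?_)
  rw [← ENNReal.ofReal_rpow_of_nonneg (by positivity) (by positivity), ENNReal.ofReal_natCast]

theorem exists_exponent_eq {x : ℝ≥0∞} (hx : x ∈ ({1} ∪ Set.Icc 2 ∞ : Set ℝ≥0∞)) :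
    ∃ P : ComAugmentedOperad.{u, u} k, P.LocallyFinite ∧ P.exponent = x := by
  rcases hx with rfl | ⟨hx, -⟩
  · exact ⟨_, locallyFinite, exponent_eq_one k⟩
  · rcases eq_or_ne x ∞ with rfl | hx'
    · exact ⟨_, locallyFinite, exponent_eq_top k⟩
    · refine ⟨_, locallyFinite, (exponent_eq_ofReal k (r := x.toReal) ?_).trans
        (ENNReal.ofReal_toReal hx')⟩
      exact (ENNReal.toReal_mono hx' hx).trans' (by simp)

end SquareZeroOperad

theorem theorem0p8 (k : Type u) [Field k] :
    (∀ d : ℕ+ → ℕ, ∃ P : ComAugmentedOperad.{u, u} k,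
      P.signature = fun n => (d n : Cardinal)) ∧
    ((fun P : ComAugmentedOperad.{u, u} k => P.exponent) '' {P | P.LocallyFinite} =
      {1} ∪ Set.Icc 2 ∞) ∧
    ((fun P : TwoUnitaryOperad.{u, u} k => P.exponent) '' {P | P.LocallyFinite} =
      {1} ∪ Set.Icc 2 ∞) := by
  refine ⟨fun d => ?_, Set.Subset.antisymm ?_ fun x hx => ?_,
    Set.Subset.antisymm ?_ fun x hx => ?_⟩
  -- The value `toPNat'` supplies at 0 is harmless, because only nonempty sets carry labels.
  · refine ⟨squareZeroComAugmented k fun n => d (Nat.toPNat' n), funext fun n => ?_⟩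
    rw [SquareZeroOperad.signature_eq, PNat.coe_toPNat']
  · rintro _ ⟨P, hP, rfl⟩
    exact P.toTwoUnitaryOperad.exponent_mem hP
  · obtain ⟨P, hP, h⟩ := SquareZeroOperad.exists_exponent_eq k hx
    exact ⟨P, hP, h⟩
  · rintro _ ⟨P, hP, rfl⟩
    exact P.exponent_mem hP
  · obtain ⟨P, hP, h⟩ := SquareZeroOperad.exists_exponent_eq k hx
    exact ⟨P.toTwoUnitaryOperad, hP, h⟩
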